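/- Let $k$ be a field. **Pointed rational functions.** For a $k$-algebra $R$ which is a domain, a pointed rational function of degree $n\ge 0$ over $R$ is a pair $A/B$ of polynomials in $R[X]$ with $A$ monic of degree $n$, $\deg B<n$, and $\mathrm{res}_{n,n}(A,B)\in R^\times$ (in degree $0$ there is only $1/0$); write $\mathrm{res}(A/B)=\mathrm{res}_{n,n}(A,B)$. Over $R=k$ these correspond to the pointed endomorphisms of $(\mathbf P^1,\infty)$, and over $R=k[T]$ to pointed naive homotopies, with source and target given by $T=0$ and $T=1$. Accordingly $[\mathbf P^1,\mathbf P^1]^{\mathrm N}$ is the quotient of the set of pointed rational functions over $k$ by the equivalence relation generated by $F|_{T=0}\sim F|_{T=1}$, for $F$ a pointed rational function over $k[T]$; it is graded by the degree. For $f_i=A_i/B_i$ let $(U_i,V_i)$ be the unique polynomials with $A_iU_i+B_iV_i=1$ and $\deg V_i<\deg A_i$. The law $\oplus^{\mathrm N}$ is induced by $\frac{A_1}{B_1}\oplus^{\mathrm N}\frac{A_2}{B_2}=\frac{A_3}{B_3}$, where $$\begin{bmatrix}A_3&-V_3\\B_3&U_3\end{bmatrix}=\begin{bmatrix}A_1&-V_1\\B_1&U_1\end{bmatrix}\begin{bmatrix}A_2&-V_2\\B_2&U_2\end{bmatrix}.$$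 **Bézout form.** For $f=A/B$ of degree $n$ over $k$, $\mathrm{B\acute ez}(f)$ is the non-degenerate symmetric bilinear form on $k^n$ with Gram matrix $[c_{p,q}]$, where $\frac{A(X)B(Y)-A(Y)B(X)}{X-Y}=\sum_{1\le p,q\le n}c_{p,q}X^{p-1}Y^{q-1}$; $\det\mathrm{B\acute ez}(f)$ denotes the determinant of this matrix. **Target.** $\mathrm{MW}^{\mathrm s}(k)$ is the monoid, under orthogonal sum, of stable isometry classes of non-degenerate symmetric bilinear forms on finite-dimensional $k$-vector spaces ($b,b'$ are stably isometric if $b\oplus b''\simeq b'\oplus b''$ for some $b''$), graded by the rank. For $n\ge1$, $\mathrm{MW}^{\mathrm s}_n(k)\times_{k^\times/k^{\times2}}k^\times$ is the set of pairs $(b,u)$ with $b$ of rank $n$ and $u\in k^\times$ representing the discriminant of $b$; for $n=0$ the component is taken to be the single element $(0,1)$. The law $\oplus$ on the disjoint union over $n\ge0$ is the orthogonal sum on the first factor and the product on the second. **Statement.** There is an isomorphism of graded monoids $$\left([\mathbf P^1,\mathbf P^1]^{\mathrm N},\oplus^{\mathrm N}\right)\;\simeq\;\Bigl(\coprod_{n\ge0}\mathrm{MW}^{\mathrm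 s}_n(k)\times_{k^\times/k^{\times2}}k^\times,\ \oplus\Bigr)$$ which sends the class of $f$ to $\bigl([\mathrm{B\acute ez}(f)],\det\mathrm{B\acute ez}(f)\bigr)$. Moreover $\det\mathrm{B\acute ez}(f)=(-1)^{n(n-1)/2}\,\mathrm{res}(f)$ for every $f$ of degree $n$. Examples. - If $k$ is algebraically closed, $f\mapsto(\deg f,\det\mathrm{B\acute ez}(f))$ induces an isomorphism of monoids from $[\mathbf P^1,\mathbf P^1]^{\mathrm N}$ onto the submonoid of $\mathbf N\times k^\times$ of the pairs $(n,u)$ with $u=1$ if $n=0$. - If $k=\mathbf R$, let $(p,q)$ be the signature of $\mathrm{B\acute ez}(f)$ (maximal dimensions of positive and of negative definite subspaces). Then $f\mapsto((p,q),\det\mathrm{B\acute ez}(f))$ induces an isomorphism of monoids from $[\mathbf P^1,\mathbf P^1]^{\mathrm N}$ onto the submonoid of $(\mathbf N\times\mathbf N)\times\mathbf R^\times$ of the elements $((p,q),u)$ such that $u$ has the sign of $(-1)^q$, and $u=1$ if $p=q=0$. -/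

import Mathlib

open Polynomial

universe u

/-! ## Pointed rational functions -/

/-- A pointed rational function `A / B` with coefficients in `R`, of degree `n = A.natDegree`:
`A` is monic of degree `n`, `B` has degree `< n`, and the resultant `res_{n,n}(A, B)` is a unit.
(For `R` a domain these are the `R`-points of the disjoint union over `n ≥ 0` of the schemes of
pointed rational functions of degree `n`.) -/
@[ext]
structure PointedRat (R : Type u) [CommRing R] where
  /-- the numerator `A` -/
  num : R[X]
  /-- the denominator `B` -/
  den : R[X]
  monic : num.Monic
  degree_den_lt : den.degree < num.degree
  isUnit_resultant : IsUnit (resultant num den num.natDegree num.natDegree)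

namespace PointedRat

section Ring

variable {R : Type u} [CommRing R]

/-- The degree of a pointed rational function. -/
noncomputable def deg (f : PointedRat R) : ℕ := f.num.natDegree

/-- The resultant of a pointed rational function. -/
noncomputable def res (f : PointedRat R) : R := resultant f.num f.den f.deg f.deg

theorem isUnit_resultant_iff {A B : R[X]} (hA : A.Monic) (hB : B.degree < A.degree) :
    IsUnit (resultant A B A.natDegree A.natDegree) ↔ IsCoprime A B := by
  have hle : B.natDegree ≤ A.natDegree := natDegree_le_natDegree hB.le
  obtain ⟨c, hc⟩ := Nat.exists_eq_add_of_le hle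
  have h : resultant A B A.natDegree A.natDegree = resultant A B := by
    conv_lhs => rw [show resultant A B A.natDegree A.natDegree
      = resultant A B A.natDegree (B.natDegree + c) by rw [← hc]]
    rw [resultant_add_right_deg _ _ _ _ _ le_rfl, hA.coeff_natDegree, one_pow, one_mul]
  rw [h, isUnit_resultant_iff_isCoprime hA]

theorem isCoprime (f : PointedRat R) : IsCoprime f.num f.den :=
  (isUnit_resultant_iff f.monic f.degree_den_lt).1 f.isUnit_resultant

/-- A polynomial of degree less than that of a monic `A` and divisible by `A` vanishes. -/
theorem eq_zero_of_monic_dvd {A V : R[X]} (hA : A.Monic) (h : A ∣ V) (hV : V.degree < A.degree) :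
    V = 0 := by
  nontriviality R
  rw [← (modByMonic_eq_self_iff hA).2 hV, (modByMonic_eq_zero_iff_dvd hA).2 h]

theorem nontrivial (f : PointedRat R) : Nontrivial R := by
  by_contra h
  rw [not_nontrivial_iff_subsingleton] at h
  have := f.degree_den_lt
  rw [Subsingleton.elim f.den f.num] at this
  exact lt_irrefl _ this

/-- The Bézout relation `A U + B V = 1` with `deg V < deg A`. -/
theorem exists_bezout (f : PointedRat R) :
    ∃ W : R[X] × R[X], f.num * W.1 + f.den * W.2 = 1 ∧ W.2.degree < f.num.degree := by
  have := f.nontrivial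
  obtain ⟨a, b, h⟩ := f.isCoprime
  refine ⟨(a + f.den * (b /ₘ f.num), b %ₘ f.num), ?_, degree_modByMonic_lt _ f.monic⟩
  have := modByMonic_add_div b f.num
  dsimp only
  linear_combination h + f.den * this

theorem bezout_unique (f : PointedRat R) {U V U' V' : R[X]}
    (h : f.num * U + f.den * V = 1) (hV : V.degree < f.num.degree)
    (h' : f.num * U' + f.den * V' = 1) (hV' : V'.degree < f.num.degree) :
    U = U' ∧ V = V' := by
  have hd : f.num ∣ f.den * (V - V') := ⟨U' - U, by linear_combination h - h'⟩
  have hV0 : V - V' = 0 := eq_zero_of_monic_dvd f.monic (f.isCoprime.dvd_of_dvd_mul_left hd)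
    (lt_of_le_of_lt (degree_sub_le _ _) (max_lt hV hV'))
  have hVV : V = V' := sub_eq_zero.1 hV0
  subst hVV
  refine ⟨?_, rfl⟩
  have : f.num * U = f.num * U' := by linear_combination h - h'
  exact f.monic.isRegular.left this

/-- The polynomial `U` of the Bézout relation `A U + B V = 1`, `deg V < deg A`. -/
noncomputable def bezU (f : PointedRat R) : R[X] := f.exists_bezout.choose.1

/-- The polynomial `V` of the Bézout relation `A U + B V = 1`, `deg V < deg A`. -/
noncomputable def bezV (f : PointedRat R) : R[X] := f.exists_bezout.choose.2

theorem bezout (f : PointedRat R) : f.num * f.bezU + f.den * f.bezV = 1 :=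
  f.exists_bezout.choose_spec.1

theorem degree_bezV (f : PointedRat R) : f.bezV.degree < f.num.degree :=
  f.exists_bezout.choose_spec.2

/-- The bound `deg V ≤ n - 1` forces `deg U ≤ n - 2` when `n ≥ 2`; for `n = 0` one gets
`(U, V) = (1, 0)`. -/
theorem natDegree_bezU (f : PointedRat R) : f.bezU.natDegree ≤ f.deg - 2 := by
  have := f.nontrivial
  by_contra hcon
  have hU : f.bezU ≠ 0 := by
    intro h; rw [h] at hcon; simp at hcon
  have h1 : (f.num * f.bezU).natDegree = f.num.natDegree + f.bezU.natDegree :=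
    f.monic.natDegree_mul' hU
  have h2 : f.num * f.bezU = 1 - f.den * f.bezV := by linear_combination f.bezout
  have h3 : (1 - f.den * f.bezV).natDegree ≤ f.den.natDegree + f.bezV.natDegree := by
    refine (natDegree_sub_le _ _).trans ?_
    rw [natDegree_one, max_eq_right (Nat.zero_le _)]
    exact natDegree_mul_le
  have hB := natDegree_le_natDegree f.degree_den_lt.le
  have hV := natDegree_le_natDegree f.degree_bezV.le
  rw [h2] at h1
  unfold deg at hcon
  rcases Nat.eq_zero_or_pos f.num.natDegree with h0 | hpos
  · omega
  · have hB' : f.den.natDegree < f.num.natDegree := by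
      rcases eq_or_ne f.den 0 with hz | hz
      · rw [hz]; simpa using hpos
      · exact natDegree_lt_natDegree hz f.degree_den_lt
    have hV' : f.bezV.natDegree < f.num.natDegree := by
      rcases eq_or_ne f.bezV 0 with hz | hz
      · rw [hz]; simpa using hpos
      · exact natDegree_lt_natDegree hz f.degree_bezV
    omega

/-- The matrix `[A, -V; B, U]` of determinant one attached to `A / B`. -/
noncomputable def mat (f : PointedRat R) : Matrix (Fin 2) (Fin 2) R[X] :=
  !![f.num, -f.bezV; f.den, f.bezU]

theorem natDegree_bezU_le (f : PointedRat R) : f.bezU.degree ≤ f.num.degree := by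
  have := f.nontrivial
  rw [degree_eq_natDegree f.monic.ne_zero]
  refine degree_le_natDegree.trans ?_
  have := f.natDegree_bezU
  unfold deg at this
  exact_mod_cast this.trans (Nat.sub_le _ _)

theorem degree_mul_lt {A₁ A₂ P Q : R[X]} (h₁ : A₁.Monic) (h₂ : A₂.Monic)
    (hP : P.degree ≤ A₁.degree) (hQ : Q.degree < A₂.degree) :
    (P * Q).degree < (A₁ * A₂).degree := by
  have hA : (A₁ * A₂).degree = A₁.degree + A₂.degree := h₂.degree_mul
  rw [hA]
  refine lt_of_le_of_lt (degree_mul_le _ _) ?_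
  refine lt_of_le_of_lt (add_le_add_left hP _) ?_
  rcases subsingleton_or_nontrivial R with hs | hn
  · rw [Subsingleton.elim Q A₂] at hQ
    exact absurd hQ (lt_irrefl _)
  · exact WithBot.add_lt_add_left (by
      rw [Ne, degree_eq_bot]; exact h₁.ne_zero) hQ

theorem degree_mul_lt' {A₁ A₂ P Q : R[X]} (h₁ : A₁.Monic) (h₂ : A₂.Monic)
    (hP : P.degree < A₁.degree) (hQ : Q.degree ≤ A₂.degree) :
    (P * Q).degree < (A₁ * A₂).degree := by
  rw [mul_comm P, mul_comm A₁]; exact degree_mul_lt h₂ h₁ hQ hP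

/-- The sum `f ⊕ g` of pointed rational functions: the first column of the product of the two
matrices `[A, -V; B, U]`. -/
noncomputable instance : Add (PointedRat R) where
  add f g :=
    have hm : (f.num * g.num - f.bezV * g.den).Monic :=
      (f.monic.mul g.monic).sub_of_left
        (degree_mul_lt' f.monic g.monic f.degree_bezV g.degree_den_lt.le)
    have hn : (f.mat * g.mat) 0 0 = f.num * g.num - f.bezV * g.den := by
      simp [mat, Matrix.mul_apply, Fin.sum_univ_two, sub_eq_add_neg]
    have hd : (f.mat * g.mat) 1 0 = f.den * g.num + f.bezU * g.den := by
      simp [mat, Matrix.mul_apply, Fin.sum_univ_two]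
    have hdeg : (f.num * g.num - f.bezV * g.den).degree = (f.num * g.num).degree :=
      degree_sub_eq_left_of_degree_lt
        (degree_mul_lt' f.monic g.monic f.degree_bezV g.degree_den_lt.le)
    have hlt : (f.den * g.num + f.bezU * g.den).degree
        < (f.num * g.num - f.bezV * g.den).degree := by
      rw [hdeg]
      exact lt_of_le_of_lt (degree_add_le _ _) (max_lt
        (degree_mul_lt' f.monic g.monic f.degree_den_lt le_rfl)
        (degree_mul_lt f.monic g.monic f.natDegree_bezU_le g.degree_den_lt))
    { num := (f.mat * g.mat) 0 0
      den := (f.mat * g.mat) 1 0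
      monic := by rw [hn]; exact hm
      degree_den_lt := by rw [hn, hd]; exact hlt
      isUnit_resultant := by
        rw [hn, hd, isUnit_resultant_iff hm hlt]
        refine ⟨-(f.den * g.bezV) + f.bezU * g.bezU, f.num * g.bezV + f.bezV * g.bezU, ?_⟩
        have h1 := f.bezout
        have h2 := g.bezout
        linear_combination (g.num * g.bezU + g.den * g.bezV) * h1 + h2 }

theorem num_add (f g : PointedRat R) : (f + g).num = f.num * g.num - f.bezV * g.den := by
  change (f.mat * g.mat) 0 0 = _
  simp [mat, Matrix.mul_apply, Fin.sum_univ_two, sub_eq_add_neg]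

theorem den_add (f g : PointedRat R) : (f + g).den = f.den * g.num + f.bezU * g.den := by
  change (f.mat * g.mat) 1 0 = _
  simp [mat, Matrix.mul_apply, Fin.sum_univ_two]

theorem degree_num_add (f g : PointedRat R) : (f + g).num.degree = (f.num * g.num).degree := by
  rw [num_add]
  exact degree_sub_eq_left_of_degree_lt
    (degree_mul_lt' f.monic g.monic f.degree_bezV g.degree_den_lt.le)

theorem bez_add (f g : PointedRat R) :
    (f + g).bezU = -(f.den * g.bezV) + f.bezU * g.bezU ∧
      (f + g).bezV = f.num * g.bezV + f.bezV * g.bezU := by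
  refine bezout_unique (f + g) (f + g).bezout (f + g).degree_bezV ?_ ?_
  · rw [num_add, den_add]
    have h1 := f.bezout
    have h2 := g.bezout
    linear_combination (g.num * g.bezU + g.den * g.bezV) * h1 + h2
  · rw [degree_num_add]
    exact lt_of_le_of_lt (degree_add_le _ _) (max_lt
      (degree_mul_lt f.monic g.monic le_rfl g.degree_bezV)
      (degree_mul_lt' f.monic g.monic f.degree_bezV g.natDegree_bezU_le))

theorem mat_add (f g : PointedRat R) : (f + g).mat = f.mat * g.mat := by
  have h := bez_add f g
  ext i j : 2
  fin_cases i <;> fin_cases j <;>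
    simp [mat, Matrix.mul_apply, Fin.sum_univ_two, num_add, den_add, h.1, h.2] <;> ring

theorem mat_injective : Function.Injective (mat : PointedRat R → _) := by
  intro f g h
  have h0 := congrFun (congrFun h 0) 0
  have h1 := congrFun (congrFun h 1) 0
  exact PointedRat.ext (by simpa [mat] using h0) (by simpa [mat] using h1)

theorem deg_add (f g : PointedRat R) : (f + g).deg = f.deg + g.deg := by
  rw [deg, natDegree_eq_of_degree_eq (degree_num_add f g), f.monic.natDegree_mul g.monic]
  rfl

/-- The unique pointed rational function `1 / 0` of degree zero (the constant map to the base
point). -/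
noncomputable instance [Nontrivial R] : Zero (PointedRat R) where
  zero :=
    { num := 1
      den := 0
      monic := monic_one
      degree_den_lt := by rw [degree_zero, degree_one]; exact WithBot.bot_lt_coe 0
      isUnit_resultant := by simp }

theorem mat_zero [Nontrivial R] : (0 : PointedRat R).mat = 1 := by
  have h := bezout_unique (0 : PointedRat R) (bezout 0) (degree_bezV 0) (U' := 1) (V' := 0)
    (by change (1 : R[X]) * 1 + 0 * 0 = 1; simp)
    (by change (0 : R[X]).degree < (1 : R[X]).degree
        rw [degree_zero, degree_one]; exact WithBot.bot_lt_coe 0)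
  have hn : (0 : PointedRat R).num = 1 := rfl
  have hd : (0 : PointedRat R).den = 0 := rfl
  rw [mat, h.1, h.2, hn, hd, neg_zero, Matrix.one_fin_two]

/-- The monoid of pointed rational functions (in general not commutative). -/
noncomputable instance [Nontrivial R] : AddMonoid (PointedRat R) where
  add_assoc f g h := mat_injective (by simp only [mat_add, Matrix.mul_assoc])
  zero_add f := mat_injective (by simp only [mat_add, mat_zero, one_mul])
  add_zero f := mat_injective (by simp only [mat_add, mat_zero, mul_one])
  nsmul := nsmulRec

/-- Change of coefficients. -/
noncomputable def map {S : Type u} [CommRing S] [Nontrivial S] (φ : R →+* S) (f : PointedRat R) :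
    PointedRat S where
  num := f.num.map φ
  den := f.den.map φ
  monic := f.monic.map φ
  degree_den_lt := by
    have := f.nontrivial
    rw [f.monic.degree_map]
    exact lt_of_le_of_lt degree_map_le f.degree_den_lt
  isUnit_resultant := by
    rw [f.monic.natDegree_map, resultant_map_map]
    exact f.isUnit_resultant.map φ

theorem deg_map {S : Type u} [CommRing S] [Nontrivial S] (φ : R →+* S) (f : PointedRat R) :
    (f.map φ).deg = f.deg := f.monic.natDegree_map φ

theorem map_oplus {S : Type u} [CommRing S] [Nontrivial S] (φ : R →+* S) (f g : PointedRat R) :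
    (f + g).map φ = f.map φ + g.map φ := by
  have h := bezout_unique (f.map φ) (bezout _) (degree_bezV _) (U' := f.bezU.map φ)
    (V' := f.bezV.map φ)
    (by change f.num.map φ * _ + f.den.map φ * _ = 1
        rw [← Polynomial.map_mul, ← Polynomial.map_mul, ← Polynomial.map_add, f.bezout,
          Polynomial.map_one])
    (by change _ < (f.num.map φ).degree
        rw [f.monic.degree_map]
        exact lt_of_le_of_lt degree_map_le f.degree_bezV)
  refine PointedRat.ext ?_ ?_
  · rw [num_add, h.2]
    change (f + g).num.map φ = f.num.map φ * g.num.map φ - f.bezV.map φ * g.den.map φ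
    rw [num_add]; simp
  · rw [den_add, h.1]
    change (f + g).den.map φ = f.den.map φ * g.num.map φ + f.bezU.map φ * g.den.map φ
    rw [den_add]; simp

end Ring

section Field

variable {k : Type u} [Field k]

/-- `f` and `g` are joined by a pointed naive homotopy: a pointed rational function with
coefficients in `k[T]` which specialises to `f` at `T = 0` and to `g` at `T = 1`. -/
def Homotopy (f g : PointedRat k) : Prop :=
  ∃ F : PointedRat k[X], F.map (evalRingHom 0) = f ∧ F.map (evalRingHom 1) = g

theorem homotopy_refl (f : PointedRat k) : Homotopy f f := by
  refine ⟨f.map C, ?_, ?_⟩ <;>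
  · refine PointedRat.ext ?_ ?_ <;>
    · simp only [map, Polynomial.map_map]
      convert Polynomial.map_id
      ext x; simp

theorem Homotopy.add {f f' g g' : PointedRat k} (h : Homotopy f f') (h' : Homotopy g g') :
    Homotopy (f + g) (f' + g') := by
  obtain ⟨F, rfl, rfl⟩ := h
  obtain ⟨G, rfl, rfl⟩ := h'
  exact ⟨F + G, map_oplus _ _ _, map_oplus _ _ _⟩

end Field

end PointedRat

/-- The set `[ℙ¹, ℙ¹]ᴺ` of pointed naive homotopy classes: the quotient of the set of pointed
rational functions over `k` by the equivalence relation generated by pointed naive homotopies. -/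
def NaiveClass (k : Type u) [Field k] : Type u := Quot (PointedRat.Homotopy (k := k))

namespace NaiveClass

variable {k : Type u} [Field k]

/-- The naive homotopy class of a pointed rational function. -/
def mk (f : PointedRat k) : NaiveClass k := Quot.mk _ f

/-- The monoid law induced by the sum of pointed rational functions. -/
noncomputable instance : Add (NaiveClass k) where
  add := Quot.map₂ (· + ·) (fun f _ _ h => (PointedRat.homotopy_refl f).add h)
    (fun _ _ g h => h.add (PointedRat.homotopy_refl g))

noncomputable instance : Zero (NaiveClass k) where
  zero := mk 0

noncomputable instance : AddMonoid (NaiveClass k) where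
  add_assoc := by
    rintro ⟨f⟩ ⟨g⟩ ⟨h⟩
    exact congrArg mk (add_assoc f g h)
  zero_add := by
    rintro ⟨f⟩
    exact congrArg mk (zero_add f)
  add_zero := by
    rintro ⟨f⟩
    exact congrArg mk (add_zero f)
  nsmul := nsmulRec

theorem mk_add (f g : PointedRat k) : mk (f + g) = mk f + mk g := rfl

theorem mk_zero : mk (0 : PointedRat k) = 0 := rfl

/-- The grading of `[ℙ¹, ℙ¹]ᴺ` by the degree. -/
noncomputable def degree : NaiveClass k →+ ℕ where
  toFun := Quot.lift PointedRat.deg (by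
    rintro f g ⟨F, rfl, rfl⟩
    rw [PointedRat.deg_map, PointedRat.deg_map])
  map_zero' := natDegree_one
  map_add' := by
    rintro ⟨f⟩ ⟨g⟩
    exact PointedRat.deg_add f g

end NaiveClass
/-! ## The Witt monoid of stable isometry classes -/

/-- A finite-dimensional `k`-vector space with a non-degenerate symmetric bilinear form. -/
structure NDForm (k : Type u) [Field k] where
  /-- the underlying vector space -/
  V : Type u
  [addCommGroup : AddCommGroup V]
  [module : Module k V]
  [finite : FiniteDimensional k V]
  /-- the bilinear form -/
  form : LinearMap.BilinForm k V
  symm : form.IsSymm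
  nondegenerate : form.Nondegenerate

namespace NDForm

attribute [instance] NDForm.addCommGroup NDForm.module NDForm.finite

variable {k : Type u} [Field k]

/-- Two forms are isometric. -/
def Isometric (b c : NDForm k) : Prop :=
  ∃ e : b.V ≃ₗ[k] c.V, ∀ x y, c.form (e x) (e y) = b.form x y

theorem isometric_equivalence : Equivalence (Isometric (k := k)) where
  refl _ := ⟨LinearEquiv.refl _ _, fun _ _ => rfl⟩
  symm := by
    rintro b c ⟨e, he⟩
    exact ⟨e.symm, fun x y => by rw [← he, e.apply_symm_apply, e.apply_symm_apply]⟩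
  trans := by
    rintro b c d ⟨e, he⟩ ⟨e', he'⟩
    exact ⟨e.trans e', fun x y => by
      rw [LinearEquiv.trans_apply, LinearEquiv.trans_apply, he', he]⟩

instance setoid (k : Type u) [Field k] : Setoid (NDForm k) := ⟨Isometric, isometric_equivalence⟩

/-- The orthogonal sum of two bilinear forms. -/
def sumForm {V W : Type u} [AddCommGroup V] [Module k V] [AddCommGroup W] [Module k W]
    (b : LinearMap.BilinForm k V) (c : LinearMap.BilinForm k W) : LinearMap.BilinForm k (V × W) :=
  b.comp (LinearMap.fst k V W) (LinearMap.fst k V W) +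
    c.comp (LinearMap.snd k V W) (LinearMap.snd k V W)

theorem sumForm_apply {V W : Type u} [AddCommGroup V] [Module k V] [AddCommGroup W] [Module k W]
    (b : LinearMap.BilinForm k V) (c : LinearMap.BilinForm k W) (x y : V × W) :
    sumForm b c x y = b x.1 y.1 + c x.2 y.2 := rfl

/-- The orthogonal sum. -/
instance : Add (NDForm k) where
  add b c :=
    { V := b.V × c.V
      form := sumForm b.form c.form
      symm := ⟨fun x y => by
        rw [sumForm_apply, sumForm_apply, b.symm.eq, c.symm.eq]⟩
      nondegenerate := by
        refine ⟨fun x hx => Prod.ext (b.nondegenerate.1 _ fun y => ?_)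
          (c.nondegenerate.1 _ fun y => ?_), fun x hx => Prod.ext (b.nondegenerate.2 _ fun y => ?_)
          (c.nondegenerate.2 _ fun y => ?_)⟩
        · simpa [sumForm_apply] using hx (y, 0)
        · simpa [sumForm_apply] using hx (0, y)
        · simpa [sumForm_apply] using hx (y, 0)
        · simpa [sumForm_apply] using hx (0, y) }

theorem add_apply (b c : NDForm k) (x y : b.V × c.V) :
    (b + c).form x y = b.form x.1 y.1 + c.form x.2 y.2 := rfl

/-- The form on the zero space. -/
instance : Zero (NDForm k) where
  zero :=
    { V := PUnit.{u + 1}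
      form := 0
      symm := ⟨fun _ _ => rfl⟩
      nondegenerate := ⟨fun _ _ => rfl, fun _ _ => rfl⟩ }

/-- The dimension of the underlying space. -/
noncomputable def rank (b : NDForm k) : ℕ := Module.finrank k b.V

theorem rank_add (b c : NDForm k) : (b + c).rank = b.rank + c.rank :=
  Module.finrank_prod (R := k) (M := b.V) (M' := c.V)

theorem rank_zero : (0 : NDForm k).rank = 0 :=
  Module.finrank_zero_of_subsingleton (R := k) (M := PUnit.{u + 1})

/-- The determinant of the Gram matrix in a basis, a unit. -/
noncomputable def gram {ι : Type*} [Fintype ι] [DecidableEq ι] (b : NDForm k)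
    (e : Module.Basis ι k b.V) : kˣ :=
  Units.mk0 (LinearMap.BilinForm.toMatrix e b.form).det
    ((LinearMap.BilinForm.nondegenerate_iff_det_ne_zero e).1 b.nondegenerate)

/-- The discriminant: the class modulo squares of the determinant of a Gram matrix. -/
noncomputable def disc (b : NDForm k) : kˣ ⧸ Subgroup.square kˣ :=
  QuotientGroup.mk (b.gram (Module.finBasis k b.V))

theorem disc_eq {n : ℕ} (b : NDForm k) (e : Module.Basis (Fin n) k b.V) :
    b.disc = QuotientGroup.mk (b.gram e) := by
  obtain rfl : Module.finrank k b.V = n := by simpa using Module.finrank_eq_card_basis e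
  rw [disc, QuotientGroup.eq]
  set c := Module.finBasis k b.V
  have h : (c.toMatrix e).det ≠ 0 := by
    intro h0
    have := congrArg Matrix.det (c.toMatrix_mul_toMatrix_flip e)
    rw [Matrix.det_mul, h0, zero_mul, Matrix.det_one] at this
    exact zero_ne_one this
  refine ⟨Units.mk0 _ h, ?_⟩
  rw [inv_mul_eq_iff_eq_mul]
  ext
  have := congrArg Matrix.det
    (LinearMap.BilinForm.toMatrix_mul_basis_toMatrix (b := c) e b.form)
  rw [Matrix.det_mul, Matrix.det_mul, Matrix.det_transpose] at this
  simp only [gram, Units.val_mul, Units.val_mk0]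
  rw [← this]; ring

theorem disc_eq' {ι : Type*} [Fintype ι] [DecidableEq ι] (b : NDForm k)
    (e : Module.Basis ι k b.V) : b.disc = QuotientGroup.mk (b.gram e) := by
  rw [disc_eq b (e.reindex (Fintype.equivFin ι))]
  congr 1
  ext
  have : LinearMap.BilinForm.toMatrix (e.reindex (Fintype.equivFin ι)) b.form =
      (LinearMap.BilinForm.toMatrix e b.form).submatrix (Fintype.equivFin ι).symm
        (Fintype.equivFin ι).symm := by
    ext i j
    simp [LinearMap.BilinForm.toMatrix_apply]
  simp only [gram, Units.val_mk0]
  rw [this, Matrix.det_submatrix_equiv_self]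

theorem disc_isometric {b c : NDForm k} (h : Isometric b c) : b.disc = c.disc := by
  obtain ⟨e, he⟩ := h
  rw [disc_eq' c ((Module.finBasis k b.V).map e), disc]
  congr 1
  ext
  simp only [gram, Units.val_mk0]
  congr 1
  ext i j
  simp [LinearMap.BilinForm.toMatrix_apply, he]

theorem disc_zero : (0 : NDForm k).disc = 1 := by
  rw [disc_eq' (0 : NDForm k) (Module.Basis.empty (ι := Fin 0) (M := PUnit.{u + 1}))]
  have : (0 : NDForm k).gram (Module.Basis.empty (ι := Fin 0) (M := PUnit.{u + 1})) = 1 := by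
    ext
    simp [gram]
  rw [this]; rfl

theorem disc_add (b c : NDForm k) : (b + c).disc = b.disc * c.disc := by
  rw [disc_eq' (b + c) ((Module.finBasis k b.V).prod (Module.finBasis k c.V)), disc, disc,
    ← QuotientGroup.mk_mul]
  congr 1
  ext
  have : LinearMap.BilinForm.toMatrix ((Module.finBasis k b.V).prod (Module.finBasis k c.V))
      (sumForm b.form c.form) = Matrix.fromBlocks
        (LinearMap.BilinForm.toMatrix (Module.finBasis k b.V) b.form) 0 0
        (LinearMap.BilinForm.toMatrix (Module.finBasis k c.V) c.form) := by
    ext i j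
    rw [LinearMap.BilinForm.toMatrix_apply]
    rcases i with i | i <;> rcases j with j | j <;>
      simp [sumForm_apply, LinearMap.BilinForm.toMatrix_apply]
  simp only [gram, Units.val_mk0, Units.val_mul]
  rw [← Matrix.det_fromBlocks_zero₂₁ _ 0, ← this]
  rfl

end NDForm

/-- The Witt monoid `MW(k)`: isometry classes of non-degenerate symmetric bilinear forms. -/
def MW (k : Type u) [Field k] : Type (u + 1) := Quotient (NDForm.setoid k)

namespace MW

variable {k : Type u} [Field k]

/-- The isometry class of a form. -/
def mk (b : NDForm k) : MW k := Quotient.mk _ b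

/-- Addition is the orthogonal sum. -/
instance : Add (MW k) where
  add := Quotient.map₂ (· + ·) (by
    rintro b b' ⟨e, he⟩ c c' ⟨e', he'⟩
    refine ⟨LinearEquiv.prodCongr e e', fun x y => ?_⟩
    exact congrArg₂ (· + ·) (he x.1 y.1) (he' x.2 y.2))

instance : Zero (MW k) where
  zero := mk 0

theorem mk_add (b c : NDForm k) : mk (b + c) = mk b + mk c := rfl

instance : AddCommMonoid (MW k) where
  add_assoc := by
    rintro ⟨b⟩ ⟨c⟩ ⟨d⟩
    exact Quotient.sound ⟨LinearEquiv.prodAssoc k b.V c.V d.V, fun x y =>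
      (add_assoc (b.form x.1.1 y.1.1) (c.form x.1.2 y.1.2) (d.form x.2 y.2)).symm⟩
  zero_add := by
    rintro ⟨b⟩
    exact Quotient.sound ⟨LinearEquiv.uniqueProd (R := k) (M := b.V) (M₂ := PUnit.{u + 1}), fun x y =>
      (zero_add (b.form x.2 y.2)).symm⟩
  add_zero := by
    rintro ⟨b⟩
    exact Quotient.sound ⟨LinearEquiv.prodUnique (R := k) (M := b.V) (M₂ := PUnit.{u + 1}), fun x y =>
      (add_zero (b.form x.1 y.1)).symm⟩
  add_comm := by
    rintro ⟨b⟩ ⟨c⟩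
    exact Quotient.sound ⟨LinearEquiv.prodComm k b.V c.V, fun x y =>
      add_comm (c.form x.2 y.2) (b.form x.1 y.1)⟩
  nsmul := nsmulRec

/-- The rank of an isometry class. -/
noncomputable def rank : MW k →+ ℕ where
  toFun := Quotient.lift NDForm.rank (by
    rintro b c ⟨e, -⟩
    exact e.finrank_eq)
  map_zero' := NDForm.rank_zero
  map_add' := by
    rintro ⟨b⟩ ⟨c⟩
    exact NDForm.rank_add b c

/-- The discriminant of an isometry class. -/
noncomputable def disc : MW k →+ Additive (kˣ ⧸ Subgroup.square kˣ) where
  toFun := Quotient.lift (fun b => Additive.ofMul (NDForm.disc b)) (fun _ _ h =>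
    congrArg Additive.ofMul (NDForm.disc_isometric h))
  map_zero' := congrArg Additive.ofMul NDForm.disc_zero
  map_add' := by
    rintro ⟨b⟩ ⟨c⟩
    exact congrArg Additive.ofMul (NDForm.disc_add b c)

/-- Stable isometry: `b ⊕ d ≅ c ⊕ d` for some form `d`. -/
def stableCon (k : Type u) [Field k] : AddCon (MW k) where
  r b c := ∃ d, b + d = c + d
  iseqv :=
    { refl := fun _ => ⟨0, rfl⟩
      symm := fun ⟨d, h⟩ => ⟨d, h.symm⟩
      trans := fun {b c e} ⟨d, h⟩ ⟨d', h'⟩ => ⟨d + d', by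
        rw [← add_assoc, h, add_right_comm, h', add_right_comm, add_assoc]⟩ }
  add' := by
    rintro b b' c c' ⟨d, h⟩ ⟨d', h'⟩
    exact ⟨d + d', by rw [add_add_add_comm, h, h', add_add_add_comm]⟩

end MW

/-- The monoid `MWˢ(k)` of stable isometry classes of non-degenerate symmetric bilinear forms. -/
abbrev MWs (k : Type u) [Field k] : Type (u + 1) := (MW.stableCon k).Quotient

namespace MWs

variable {k : Type u} [Field k]

/-- The stable isometry class of a form. -/
def mk (b : NDForm k) : MWs k := ((MW.mk b : MW k) : (MW.stableCon k).Quotient)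

/-- The grading of `MWˢ(k)` by the rank. -/
noncomputable def rank : MWs k →+ ℕ :=
  (MW.stableCon k).lift MW.rank (by
    rintro b c ⟨d, h⟩
    have := congrArg MW.rank h
    rw [map_add, map_add] at this
    exact Nat.add_right_cancel this)

/-- The discriminant `MWˢ(k) → kˣ / kˣ²`. -/
noncomputable def disc : MWs k →+ Additive (kˣ ⧸ Subgroup.square kˣ) :=
  (MW.stableCon k).lift MW.disc (by
    rintro b c ⟨d, h⟩
    have := congrArg MW.disc h
    rw [map_add, map_add] at this
    exact add_right_cancel this)

theorem rank_mk (b : NDForm k) : rank (mk b) = Module.finrank k b.V := rfl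

theorem disc_mk (b : NDForm k) : disc (mk b) = Additive.ofMul b.disc := rfl

end MWs

/-- The graded monoid `∐ₙ MWˢₙ(k) ×_{kˣ/kˣ²} kˣ`: pairs `(b, u)` of a stable isometry class and a
unit which represents its discriminant, graded by the rank of `b`. The law is the orthogonal sum on
the first factor and the product on the second one. For `n = 0` the determinant of the form on the
zero space is `1`, so the component of degree zero consists of the neutral element only. -/
noncomputable def WittDet (k : Type u) [Field k] : AddSubmonoid (MWs k × Additive kˣ) where
  carrier := {x | MWs.disc x.1 = Additive.ofMul (QuotientGroup.mk x.2.toMul) ∧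
    (MWs.rank x.1 = 0 → x.2 = 0)}
  zero_mem' := ⟨map_zero _, fun _ => rfl⟩
  add_mem' := by
    rintro x y ⟨hx, hx'⟩ ⟨hy, hy'⟩
    refine ⟨?_, fun h => ?_⟩
    · rw [Prod.fst_add, map_add, hx, hy]; rfl
    · rw [Prod.fst_add, map_add] at h
      rw [Prod.snd_add, hx' (by omega), hy' (by omega), add_zero]

namespace WittDet

variable {k : Type u} [Field k]

/-- The degree. -/
noncomputable def degree : WittDet k →+ ℕ :=
  MWs.rank.comp ((AddMonoidHom.fst _ _).comp (WittDet k).subtype)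

end WittDet

/-! ## The Bézout form -/

namespace PointedRat

section Bezoutian

variable {R : Type u} [CommRing R]

/-- The polynomial `A(X) B(Y) - A(Y) B(X)`, as a polynomial in `X` (the outer variable) with
coefficients in `R[Y]` (`Y` being the inner variable). -/
noncomputable def cross (A B : R[X]) : R[X][X] := A.map C * C B - C A * B.map C

/-- The quotient `δ_{A,B}(X, Y)` of `A(X) B(Y) - A(Y) B(X)` by the monic polynomial `X - Y`
(`X` is the outer variable and `Y` the inner one). -/
noncomputable def bezPoly (A B : R[X]) : R[X][X] := cross A B /ₘ (X - C X)

theorem eval_map_C (A : R[X]) : (A.map C).eval X = A := by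
  rw [eval_map, eval₂_C_X]

/-- The division is exact. -/
theorem bezPoly_spec (A B : R[X]) : (X - C X) * bezPoly A B = cross A B := by
  rw [bezPoly, mul_divByMonic_eq_iff_isRoot, IsRoot, cross, eval_sub, eval_mul, eval_mul, eval_C,
    eval_C, eval_map_C, eval_map_C, sub_self]

theorem bezPoly_unique {A B : R[X]} {P : R[X][X]} (h : (X - C X) * P = cross A B) :
    bezPoly A B = P :=
  (monic_X_sub_C (X : R[X])).isRegular.left ((bezPoly_spec A B).trans h.symm)

theorem coeff_swap (P : R[X][X]) (p q : ℕ) :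
    ((Bivariate.swap P).coeff p).coeff q = (P.coeff q).coeff p := by
  induction P using Polynomial.induction_on' with
  | add P Q hP hQ => simp only [map_add, coeff_add, hP, hQ]
  | monomial n A =>
    rw [Bivariate.swap_monomial, coeff_mul_C, coeff_map, coeff_C_mul, coeff_X_pow, coeff_monomial]
    by_cases h : q = n
    · subst h; simp
    · rw [if_neg h, if_neg (Ne.symm h)]; simp

theorem coeff_bezPoly_comm (A B : R[X]) (p q : ℕ) :
    ((bezPoly A B).coeff p).coeff q = ((bezPoly A B).coeff q).coeff p := by
  have h : bezPoly A B = Bivariate.swap (bezPoly A B) := by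
    refine bezPoly_unique ?_
    have h1 := congrArg Bivariate.swap (bezPoly_spec A B)
    simp only [cross, map_mul, map_sub, Bivariate.swap_Y, Bivariate.swap_C,
      Bivariate.swap_map_C, Polynomial.map_X] at h1 ⊢
    linear_combination -h1
  conv_lhs => rw [h]
  exact coeff_swap _ _ _

theorem coeff_bezPoly_of_le {A B : R[X]} {n j : ℕ} (hA : A.natDegree ≤ n) (hB : B.natDegree ≤ n)
    (hj : n ≤ j) : (bezPoly A B).coeff j = 0 := by
  nontriviality R
  by_cases h0 : bezPoly A B = 0
  · rw [h0, coeff_zero]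
  have h1 := (monic_X_sub_C (X : R[X])).natDegree_mul' h0
  rw [bezPoly_spec, natDegree_X_sub_C] at h1
  have h2 : (cross A B).natDegree ≤ n := by
    refine (natDegree_sub_le _ _).trans (max_le ?_ ?_)
    · exact (natDegree_mul_C_le _ _).trans (natDegree_map_le.trans hA)
    · exact (natDegree_C_mul_le _ _).trans (natDegree_map_le.trans hB)
  exact coeff_eq_zero_of_natDegree_lt (by omega)

/-- The Gram matrix `[c_{p,q}]` of the Bézout form: the coefficients of `δ_{A,B}`. -/
noncomputable def bezMatrix (f : PointedRat R) : Matrix (Fin f.deg) (Fin f.deg) R :=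
  Matrix.of fun p q => ((bezPoly f.num f.den).coeff p).coeff q

theorem bezMatrix_isSymm (f : PointedRat R) : f.bezMatrix.IsSymm := by
  ext p q
  exact coeff_bezPoly_comm _ _ _ _

end Bezoutian

section Field

variable {k : Type u} [Field k]

theorem coeff_bezPoly_one (A : k[X]) (j : ℕ) :
    (bezPoly A 1).coeff j = A.coeff (j + 1) • 1 + X * (bezPoly A 1).coeff (j + 1) := by
  have h := congrArg (fun P : k[X][X] => P.coeff (j + 1)) (bezPoly_spec A 1)
  simp only [cross, sub_mul, coeff_sub, coeff_X_mul, coeff_C_mul, map_one, mul_one,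
    Polynomial.map_one, coeff_map, coeff_C_succ, sub_zero] at h
  rw [smul_eq_C_mul, mul_one]
  linear_combination h

theorem monic_coeff_bezPoly_one {A : k[X]} (hA : A.Monic) (i : ℕ) :
    ∀ j, i + j + 1 = A.natDegree →
      ((bezPoly A 1).coeff j).Monic ∧ ((bezPoly A 1).coeff j).natDegree = i := by
  induction i with
  | zero =>
    intro j hj
    have hj' : j + 1 = A.natDegree := by omega
    have : (bezPoly A 1).coeff j = 1 := by
      rw [coeff_bezPoly_one, coeff_bezPoly_of_le le_rfl (by simp) hj'.ge, hj', hA.coeff_natDegree]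
      simp
    rw [this]
    exact ⟨monic_one, natDegree_one⟩
  | succ i ih =>
    intro j hj
    obtain ⟨h1, h2⟩ := ih (j + 1) (by omega)
    have hX : (X * (bezPoly A 1).coeff (j + 1)).Monic := monic_X.mul h1
    have hd : (X * (bezPoly A 1).coeff (j + 1)).natDegree = i + 1 := by
      rw [monic_X.natDegree_mul h1, natDegree_X, h2, add_comm]
    have hlt : (A.coeff (j + 1) • (1 : k[X])).degree
        < (X * (bezPoly A 1).coeff (j + 1)).degree := by
      rw [degree_eq_natDegree hX.ne_zero, hd, smul_eq_C_mul, mul_one]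
      exact lt_of_le_of_lt degree_C_le (by exact_mod_cast Nat.succ_pos i)
    rw [coeff_bezPoly_one]
    exact ⟨hX.add_of_right hlt, (natDegree_add_eq_right_of_degree_lt hlt).trans hd⟩

theorem bezPoly_eq (A B : k[X]) : bezPoly A B = C B * bezPoly A 1 - C A * bezPoly B 1 := by
  refine bezPoly_unique ?_
  have h1 := bezPoly_spec A 1
  have h2 := bezPoly_spec B 1
  simp only [cross, Polynomial.map_one, map_one, mul_one] at h1 h2 ⊢
  linear_combination C B * h1 - C A * h2

theorem coeff_coeff_bezPoly (f : PointedRat k) (p q : ℕ) (hq : f.deg ≤ q) :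
    ((bezPoly f.num f.den).coeff p).coeff q = 0 := by
  rw [coeff_bezPoly_comm, coeff_bezPoly_of_le le_rfl
    (natDegree_le_natDegree f.degree_den_lt.le) hq, coeff_zero]

theorem det_bezMatrix_ne_zero (f : PointedRat k) : f.bezMatrix.det ≠ 0 := by
  intro hdet
  obtain ⟨v, hv, hv0⟩ := Matrix.exists_vecMul_eq_zero_iff.2 hdet
  have hS : ∑ p : Fin f.deg, C (v p) * (bezPoly f.num f.den).coeff p = 0 := by
    ext q
    rw [finsetSum_coeff, coeff_zero]
    simp only [coeff_C_mul]
    rcases lt_or_ge q f.deg with hq | hq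
    · exact congrFun hv0 ⟨q, hq⟩
    · exact Finset.sum_eq_zero fun p _ => by rw [coeff_coeff_bezPoly f p q hq, mul_zero]
  set D : k[X] := ∑ p : Fin f.deg, C (v p) * (bezPoly f.num 1).coeff p with hD
  have hmon : ∀ p : Fin f.deg, ((bezPoly f.num 1).coeff p).Monic ∧
      ((bezPoly f.num 1).coeff p).natDegree = f.deg - 1 - p := fun p =>
    monic_coeff_bezPoly_one f.monic _ _ (by have := p.2; unfold deg at *; omega)
  have hdvd : f.num ∣ f.den * D := by
    refine ⟨∑ p : Fin f.deg, C (v p) * (bezPoly f.den 1).coeff p, ?_⟩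
    rw [← sub_eq_zero, ← hS, hD, Finset.mul_sum, Finset.mul_sum, ← Finset.sum_sub_distrib]
    refine Finset.sum_congr rfl fun p _ => ?_
    rw [bezPoly_eq f.num f.den, coeff_sub, coeff_C_mul, coeff_C_mul]
    ring
  have hD0 : D = 0 := by
    refine eq_zero_of_monic_dvd f.monic (f.isCoprime.dvd_of_dvd_mul_left hdvd) ?_
    rw [degree_eq_natDegree f.monic.ne_zero, degree_lt_iff_coeff_zero]
    intro m hm
    rw [hD, finsetSum_coeff]
    refine Finset.sum_eq_zero fun p _ => ?_
    rw [coeff_C_mul, coeff_eq_zero_of_natDegree_lt, mul_zero]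
    rw [(hmon p).2]
    have := p.2
    unfold deg at *
    omega
  have key : ∀ m : ℕ, ∀ p : Fin f.deg, (p : ℕ) = m → v p = 0 := by
    intro m
    induction m using Nat.strong_induction_on with
    | _ m ih =>
      intro p hp
      have h := congrArg (fun P : k[X] => P.coeff (f.deg - 1 - p)) hD0
      simp only [hD, finsetSum_coeff, coeff_C_mul, coeff_zero] at h
      rw [Finset.sum_eq_single p] at h
      · rw [← (hmon p).2, (hmon p).1.coeff_natDegree, mul_one] at h
        exact h
      · intro q _ hqp
        rcases lt_or_ge (q : ℕ) p with hlt | hge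
        · rw [ih q (hp ▸ hlt) q rfl, zero_mul]
        · have hne : (q : ℕ) ≠ p := fun h => hqp (Fin.ext h)
          rw [coeff_eq_zero_of_natDegree_lt, mul_zero]
          rw [(hmon q).2]
          have := q.2
          omega
      · intro hp'
        exact absurd (Finset.mem_univ p) hp'
  exact hv (funext fun p => key p p rfl)

/-- The determinant of the Bézout form, a unit. -/
noncomputable def bezDet (f : PointedRat k) : kˣ := Units.mk0 f.bezMatrix.det f.det_bezMatrix_ne_zero

/-- The Bézout form of a pointed rational function of degree `n`: the non-degenerate symmetric
bilinear form on `kⁿ` with Gram matrix `bezMatrix`. -/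
noncomputable def bezForm (f : PointedRat k) : NDForm k where
  V := Fin f.deg → k
  form := Matrix.toBilin' f.bezMatrix
  symm := Matrix.isSymm_toBilin'_iff_isSymm.2 f.bezMatrix_isSymm
  nondegenerate :=
    LinearMap.BilinForm.nondegenerate_toBilin'_iff_det_ne_zero.2 f.det_bezMatrix_ne_zero

end Field
end PointedRat

/-! ## The explicit targets over algebraically closed fields and over the real numbers -/

/-- The submonoid of `ℕ × kˣ` of the pairs `(n, u)` with `u = 1` if `n = 0`. -/
def DegDet (k : Type u) [Field k] : AddSubmonoid (ℕ × Additive kˣ) where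
  carrier := {x | x.1 = 0 → x.2 = 0}
  zero_mem' := fun _ => rfl
  add_mem' := by
    rintro x y hx hy h
    rw [Prod.fst_add] at h
    rw [Prod.snd_add, hx (by omega), hy (by omega), add_zero]

/-- The submonoid of `(ℕ × ℕ) × ℝˣ` of the elements `((p, q), u)` such that `u` has the sign of
`(-1) ^ q`, and such that `u = 1` if `p = q = 0`. -/
def SigDet : AddSubmonoid ((ℕ × ℕ) × Additive ℝˣ) where
  carrier := {x | (0 < (x.2.toMul : ℝ) ↔ Even x.1.2) ∧ (x.1 = 0 → x.2 = 0)}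
  zero_mem' := ⟨by simp, fun _ => rfl⟩
  add_mem' := by
    rintro x y ⟨hx, hx'⟩ ⟨hy, hy'⟩
    refine ⟨?_, fun h => ?_⟩
    · have h1 := (x.2.toMul : ℝˣ).ne_zero
      have h2 := (y.2.toMul : ℝˣ).ne_zero
      rw [Prod.fst_add, Prod.snd_add, Prod.snd_add, Nat.even_add, ← hx, ← hy, toMul_add,
        Units.val_mul]
      rcases lt_or_gt_of_ne h1 with h1 | h1 <;> rcases lt_or_gt_of_ne h2 with h2 | h2
      · simp [mul_pos_of_neg_of_neg h1 h2, h1.le.not_gt, h2.le.not_gt]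
      · simp [(mul_neg_of_neg_of_pos h1 h2).le.not_gt, h1.le.not_gt, h2]
      · simp [(mul_neg_of_pos_of_neg h1 h2).le.not_gt, h1, h2.le.not_gt]
      · simp [mul_pos h1 h2, h1, h2]
    · rw [Prod.fst_add, add_eq_zero] at h
      rw [Prod.snd_add, hx' h.1, hy' h.2, add_zero]

/-- The signature `(p, q)` of the Bézout form of a pointed rational function over `ℝ`: the maximal
dimensions of a positive definite and of a negative definite subspace. -/
noncomputable def PointedRat.signature (f : PointedRat ℝ) : ℕ × ℕ :=
  (sigPos f.bezForm.form.toQuadraticMap,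
    sigNeg f.bezForm.form.toQuadraticMap)

/-! Write `⟨u⟩` for the class of `X / u`. Both sides of the isomorphism are generated in degree one:
`[ℙ¹, ℙ¹]ᴺ` by the `⟨u⟩`, and `MWˢ(k)` by the forms of rank one. The proof compares the relations
between these generators.

Generation (`exists_eq_linSum`). The Euclidean algorithm writes `A / B` as a sum of functions `P /
b` with `b` constant. A linear homotopy replaces `P` by a power of `X`, and a second homotopy adds
to the constant denominator a monomial of degree one less than the numerator. The first Euclidean
quotient is then linear, so some `⟨u⟩` splits off. On the side of forms, `exists_eq_diag`
diagonalises stably; in characteristic 2 an alternating plane becomes diagonal only after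
stabilisation.

The map is well defined and additive. The Bézout polynomial of `X / u ⊕ A / B` is `u A(X) A(Y)` plus
that of `A / B`, so a unipotent base change gives `⟨u⟩ ⊕ Béz(A / B)`; additivity follows by
generation. A homotopy gives a unimodular symmetric matrix over `k[T]`, and `ofMatrix_eval_eq` shows
that its specialisations are stably isometric. If the matrix is anisotropic, a value of minimal
degree has degree zero, because `mul_le_natDegree_det` bounds the degree of the determinant below by
rank times minimal degree; this constant value splits off. If it is isotropic, a unimodular plane
`[0, v; v, c]` splits off, and its stable class depends only on the constant `v`.

Injectivity (`eq_of_bez_eq`). In degree two, a polynomial path of symmetric matrices of constant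
determinant is a homotopy. Shears then give `⟨u⟩ + ⟨v⟩ = ⟨c⟩ + ⟨uv/c⟩` whenever `u a² + v b² = c ≠
0`, and `⟨u⟩ + ⟨v⟩ = ⟨1⟩ + ⟨uv⟩` for an isotropic binary form. Consequently a diagonal sum of length
at least two splits off any non-zero value of its form, and also `⟨1⟩` if the form is isotropic. For
stably isometric `b` and `c`, `exists_submodule_of_mk_eq` provides a large subspace of `b × c` on
which the two forms take equal values. Hence they share a non-zero value or are both isotropic, so a
common `⟨c⟩` can be removed. The induction ends in degree one, where the determinant decides.

Surjectivity (`exists_bez_eq`): multiplying one diagonal entry by a square keeps the form and moves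
the determinant through its square class. -/

/-! ## Elementary pointed rational functions and homotopies -/

namespace PointedRat

section Ring

variable {R : Type u} [CommRing R]

/-- The pointed rational function `A / B` attached to coprime polynomials. -/
noncomputable def ofCoprime (A B : R[X]) (hA : A.Monic) (hB : B.degree < A.degree)
    (h : IsCoprime A B) : PointedRat R where
  num := A
  den := B
  monic := hA
  degree_den_lt := hB
  isUnit_resultant := (isUnit_resultant_iff hA hB).2 h

/-- The pointed rational function `P / b` for a monic polynomial `P` of positive degree and a
unit `b`. -/
noncomputable def divConst (P : R[X]) (hP : P.Monic) (hd : 0 < P.natDegree) (b : Rˣ) :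
    PointedRat R :=
  ofCoprime P (C (b : R)) hP (degree_C_le.trans_lt (natDegree_pos_iff_degree_pos.1 hd))
    ⟨0, C (↑b⁻¹ : R), by rw [zero_mul, zero_add, ← C_mul, Units.inv_mul, C_1]⟩

theorem bez_divConst (P : R[X]) (hP : P.Monic) (hd : 0 < P.natDegree) (b : Rˣ) :
    (divConst P hP hd b).bezU = 0 ∧ (divConst P hP hd b).bezV = C (↑b⁻¹ : R) := by
  refine bezout_unique _ (bezout _) (degree_bezV _) ?_ ?_
  · change P * 0 + C (b : R) * C (↑b⁻¹ : R) = 1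
    rw [mul_zero, zero_add, ← C_mul, Units.mul_inv, C_1]
  · exact degree_C_le.trans_lt (natDegree_pos_iff_degree_pos.1 hd)

theorem num_divConst_add (P : R[X]) (hP : P.Monic) (hd : 0 < P.natDegree) (b : Rˣ)
    (g : PointedRat R) :
    (divConst P hP hd b + g).num = P * g.num - C (↑b⁻¹ : R) * g.den := by
  rw [num_add, (bez_divConst P hP hd b).2]; rfl

theorem den_divConst_add (P : R[X]) (hP : P.Monic) (hd : 0 < P.natDegree) (b : Rˣ)
    (g : PointedRat R) :
    (divConst P hP hd b + g).den = C (b : R) * g.num := by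
  rw [den_add, (bez_divConst P hP hd b).1, zero_mul, add_zero]; rfl

/-- The pointed rational function `X / u`. -/
noncomputable def lin [Nontrivial R] (u : Rˣ) : PointedRat R :=
  divConst X monic_X (by rw [natDegree_X]; exact one_pos) u

theorem deg_lin [Nontrivial R] (u : Rˣ) : (lin u).deg = 1 := natDegree_X

theorem num_lin_add [Nontrivial R] (u : Rˣ) (g : PointedRat R) :
    (lin u + g).num = X * g.num - C (↑u⁻¹ : R) * g.den := num_divConst_add _ _ _ _ _

theorem den_lin_add [Nontrivial R] (u : Rˣ) (g : PointedRat R) :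
    (lin u + g).den = C (u : R) * g.num := den_divConst_add _ _ _ _ _

end Ring

section Field

variable {k : Type u} [Field k]

theorem Homotopy.of_family {A B : k[X][X]} (hA : A.Monic) (hB : B.degree < A.degree)
    (h : IsCoprime A B) {f g : PointedRat k}
    (h₀ : A.map (evalRingHom 0) = f.num) (h₀' : B.map (evalRingHom 0) = f.den)
    (h₁ : A.map (evalRingHom 1) = g.num) (h₁' : B.map (evalRingHom 1) = g.den) :
    Homotopy f g :=
  ⟨ofCoprime A B hA hB h, PointedRat.ext h₀ h₀', PointedRat.ext h₁ h₁'⟩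

theorem den_ne_zero {f : PointedRat k} (h : 0 < f.deg) : f.den ≠ 0 := by
  intro h0
  have := f.isCoprime
  rw [h0, isCoprime_zero_right] at this
  exact h.ne' (natDegree_eq_zero_of_isUnit this)

theorem eq_zero_of_deg_eq_zero {f : PointedRat k} (h : f.deg = 0) : f = 0 := by
  have h1 : f.num = 1 := f.monic.natDegree_eq_zero.1 h
  have h2 := f.degree_den_lt
  rw [h1, degree_one] at h2
  refine PointedRat.ext h1 ?_
  exact degree_eq_bot.1 (Nat.WithBot.lt_zero_iff.1 h2)

/-- One step of the Euclidean algorithm. -/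
theorem exists_eq_divConst_add (f : PointedRat k) (h : 0 < f.deg) :
    ∃ (P : k[X]) (hP : P.Monic) (hd : 0 < P.natDegree) (b : kˣ) (g : PointedRat k),
      f = divConst P hP hd b + g ∧ g.deg = f.den.natDegree := by
  have hB := den_ne_zero h
  set c : kˣ := Units.mk0 f.den.leadingCoeff (leadingCoeff_ne_zero.2 hB) with hc
  -- Division needs a monic divisor, so `B` is normalised by its leading coefficient `c`. With `A =
  -- P A₂ + r`, the remaining summand is `A₂ / (-c r)`.
  set A₂ : k[X] := C (↑c⁻¹ : k) * f.den with hA₂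
  have hcB : C (c : k) * A₂ = f.den := by
    rw [hA₂, ← mul_assoc, ← C_mul, Units.mul_inv, C_1, one_mul]
  have hmon : A₂.Monic := by
    rw [hA₂, Monic, leadingCoeff_mul, leadingCoeff_C, ← Units.val_mk0 (leadingCoeff_ne_zero.2 hB),
      ← hc, Units.inv_mul]
  have hdeg : A₂.degree = f.den.degree := by
    rw [hA₂, degree_C_mul (Units.ne_zero _)]
  have hdiv := modByMonic_add_div f.num A₂
  have hle : A₂.degree ≤ f.num.degree := hdeg ▸ f.degree_den_lt.le
  have hP : (f.num /ₘ A₂).Monic := by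
    rw [Monic, leadingCoeff_divByMonic_of_monic hmon hle, f.monic]
  have hPd : 0 < (f.num /ₘ A₂).natDegree := by
    rw [natDegree_divByMonic _ hmon, natDegree_eq_of_degree_eq hdeg]
    have := natDegree_lt_natDegree hB f.degree_den_lt
    omega
  have hlt : (-(C (c : k) * (f.num %ₘ A₂))).degree < A₂.degree := by
    rw [degree_neg, degree_C_mul (Units.ne_zero _)]
    exact degree_modByMonic_lt _ hmon
  have hcop : IsCoprime A₂ (-(C (c : k) * (f.num %ₘ A₂))) := by
    obtain ⟨a, b, hab⟩ := f.isCoprime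
    have h1 : C (c : k) * C (↑c⁻¹ : k) = 1 := by rw [← C_mul, Units.mul_inv, C_1]
    refine ⟨a * (f.num /ₘ A₂) + b * C (c : k), -(a * C (↑c⁻¹ : k)), ?_⟩
    linear_combination hab + a * hdiv + b * hcB + a * (f.num %ₘ A₂) * h1
  refine ⟨_, hP, hPd, c, ofCoprime A₂ _ hmon hlt hcop, PointedRat.ext ?_ ?_,
    natDegree_eq_of_degree_eq hdeg⟩
  · rw [num_divConst_add]
    have h1 : C (↑c⁻¹ : k) * C (c : k) = 1 := by rw [← C_mul, Units.inv_mul, C_1]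
    change _ = _ * A₂ - _ * (-(C (c : k) * (f.num %ₘ A₂)))
    linear_combination -hdiv - (f.num %ₘ A₂) * h1
  · rw [den_divConst_add]
    exact hcB.symm

end Field

end PointedRat

/-! ### Generation of the naive homotopy classes by the `X / u` -/

namespace NaiveClass

open PointedRat

variable {k : Type u} [Field k]

theorem mk_eq {f g : PointedRat k} (h : Homotopy f g) : mk f = mk g := Quot.sound h

/-- The naive homotopy class of `X / u`. -/
noncomputable def lin (u : kˣ) : NaiveClass k := mk (PointedRat.lin u)

/-- The segment from `P` to `X ^ n` consists of monic polynomials of degree `n`, and a constant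
non-zero denominator is coprime to all of them. In `k[X][X]` the homotopy parameter `T` is `C X`. -/
theorem mk_divConst (P : k[X]) (hP : P.Monic) (hd : 0 < P.natDegree) (b : kˣ) :
    mk (divConst P hP hd b) =
      mk (divConst (X ^ P.natDegree) (monic_X_pow _) (by rwa [natDegree_X_pow]) b) := by
  have h0 : (C (X : k[X]) * (X ^ P.natDegree - P).map C).degree < (P.map C).degree := by
    rw [degree_map_eq_of_injective (C_injective)]
    refine (degree_mul_le _ _).trans_lt ?_
    refine lt_of_le_of_lt (add_le_of_nonpos_left degree_C_le) ?_
    rw [degree_map_eq_of_injective (C_injective)]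
    have h2 : (X ^ P.natDegree : k[X]).degree = P.degree := by
      rw [degree_X_pow, degree_eq_natDegree hP.ne_zero]
    have := degree_sub_lt_left h2 (pow_ne_zero _ X_ne_zero)
      (by rw [hP.leadingCoeff, (monic_X_pow _).leadingCoeff])
    rwa [h2] at this
  refine mk_eq (Homotopy.of_family (A := P.map C + C X * (X ^ P.natDegree - P).map C)
    (B := C (C (b : k))) ((hP.map C).add_of_left h0) ?_ ?_ ?_ ?_ ?_ ?_)
  · rw [degree_add_eq_left_of_degree_lt h0, degree_map_eq_of_injective (C_injective)]
    exact degree_C_le.trans_lt (natDegree_pos_iff_degree_pos.1 hd)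
  · refine ⟨0, C (C (↑b⁻¹ : k)), ?_⟩
    rw [zero_mul, zero_add, ← C_mul, ← C_mul, Units.inv_mul, C_1, C_1]
  all_goals simp [divConst, ofCoprime, Polynomial.map_map, evalRingHom]

theorem deg_divConst (P : k[X]) (hP : P.Monic) (hd : 0 < P.natDegree) (b : kˣ) :
    (divConst P hP hd b).deg = P.natDegree := rfl

theorem mk_divConst_of_natDegree_eq_one {P : k[X]} (hP : P.Monic) (hd : P.natDegree = 1)
    (b : kˣ) : mk (divConst P hP (hd ▸ one_pos) b) = lin b := by
  -- The polynomial occurs in the type of the proofs carried by `divConst`, so the equality `Q = X`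
  -- is substituted rather than rewritten.
  have key : ∀ (Q : k[X]) (hQ : Q.Monic) (hd' : 0 < Q.natDegree), Q = X →
      mk (divConst Q hQ hd' b) = lin b := by
    rintro _ _ _ rfl
    rfl
  rw [mk_divConst]
  exact key _ _ _ (by rw [hd, pow_one])

/-- When the degrees of numerator and denominator differ by one, the first Euclidean quotient is
linear, and a linear `P / b` is homotopic to `X / b`. -/
theorem exists_mk_eq_of_natDegree_den (f : PointedRat k) (h : f.den.natDegree + 1 = f.deg) :
    ∃ (u : kˣ) (g : PointedRat k), g.deg + 1 = f.deg ∧ mk f = lin u + mk g := by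
  obtain ⟨P, hP, hd, b, g, hfg, hg⟩ := f.exists_eq_divConst_add (by omega)
  have hdeg := congrArg deg hfg
  rw [deg_add, deg_divConst, hg] at hdeg
  refine ⟨b, g, by omega, ?_⟩
  rw [← mk_divConst_of_natDegree_eq_one hP (by omega) b, ← mk_add, ← hfg]

/-- For exponent at least two, the homotopy `X ^ (m + 2) / (T X ^ (m + 1) + b)` raises the degree of
the denominator to one less than that of the numerator. It stays coprime because modulo `X` the
denominator is the unit `b`. -/
theorem exists_mk_divConst_X_pow (m : ℕ) (b : kˣ) :
    ∃ (u : kˣ) (g : PointedRat k), g.deg = m ∧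
      mk (divConst (X ^ (m + 1)) (monic_X_pow _) (by rw [natDegree_X_pow]; omega) b)
        = lin u + mk g := by
  rcases m with - | m
  · refine ⟨b, 0, natDegree_one, ?_⟩
    rw [← mk_divConst_of_natDegree_eq_one (P := X ^ (0 + 1)) (monic_X_pow _) (natDegree_X_pow _) b,
      mk_zero, add_zero]
  have hnd : (X ^ (m + 1) + C (b : k)).natDegree = m + 1 := natDegree_X_pow_add_C
  have hmon : (X ^ (m + 1) + C (b : k)).Monic := monic_X_pow_add_C _ (Nat.succ_ne_zero m)
  have hbu : C (↑b⁻¹ : k) * C (b : k) = 1 := by rw [← C_mul, Units.inv_mul, C_1]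
  have hlt : (X ^ (m + 1) + C (b : k)).degree < (X ^ (m + 1 + 1) : k[X]).degree := by
    rw [degree_X_pow, degree_eq_natDegree hmon.ne_zero, hnd]
    exact_mod_cast Nat.lt_succ_self _
  have hcop : IsCoprime (X ^ (m + 1 + 1) : k[X]) (X ^ (m + 1) + C (b : k)) := by
    have h0 : IsCoprime (X ^ (m + 1) : k[X]) (X ^ (m + 1) + C (b : k)) :=
      ⟨-C (↑b⁻¹ : k), C (↑b⁻¹ : k), by linear_combination hbu⟩
    have h1 : IsCoprime (X : k[X]) (X ^ (m + 1) + C (b : k)) :=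
      IsCoprime.of_isCoprime_of_dvd_left h0 (dvd_pow_self _ (Nat.succ_ne_zero m))
    exact IsCoprime.pow_left h1
  obtain ⟨u, g, hg, h⟩ := exists_mk_eq_of_natDegree_den
    (ofCoprime _ _ (monic_X_pow (m + 1 + 1)) hlt hcop) (by
      change (X ^ (m + 1) + C (b : k)).natDegree + 1 = (X ^ (m + 1 + 1) : k[X]).natDegree
      rw [hnd, natDegree_X_pow])
  refine ⟨u, g, ?_, ?_⟩
  · change g.deg + 1 = (X ^ (m + 1 + 1) : k[X]).natDegree at hg
    rw [natDegree_X_pow] at hg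
    omega
  rw [← h]
  have hbu' : C (C (↑b⁻¹ : k)) * C (C (b : k)) = (1 : k[X][X]) := by rw [← C_mul, hbu, C_1]
  refine mk_eq (Homotopy.of_family (A := X ^ (m + 1 + 1))
    (B := C X * X ^ (m + 1) + C (C (b : k))) (monic_X_pow _) ?_ ?_ ?_ ?_ ?_ ?_)
  · rw [degree_X_pow]
    refine (degree_add_le _ _).trans_lt (max_lt ((degree_C_mul_X_pow_le _ _).trans_lt ?_)
      (degree_C_le.trans_lt ?_))
    · exact_mod_cast Nat.lt_succ_self _
    · exact_mod_cast Nat.succ_pos _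
  · have h1 : IsCoprime (X : k[X][X]) (C X * X ^ (m + 1) + C (C (b : k))) :=
      ⟨-(C (C (↑b⁻¹ : k)) * C X * X ^ m), C (C (↑b⁻¹ : k)), by linear_combination hbu'⟩
    exact IsCoprime.pow_left h1
  all_goals simp [divConst, ofCoprime, evalRingHom]

/-- Up to naive homotopy, every pointed rational function of positive degree splits off some
`X / u`. -/
theorem exists_mk_eq_lin_add {n : ℕ} (f : PointedRat k) (h : f.deg = n + 1) :
    ∃ (u : kˣ) (g : PointedRat k), g.deg = n ∧ mk f = lin u + mk g := by
  obtain ⟨P, hP, hd, b, g, hfg, hg⟩ := f.exists_eq_divConst_add (by omega)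
  have hdeg := congrArg deg hfg
  rw [deg_add, deg_divConst] at hdeg
  obtain ⟨m, hm⟩ : ∃ m, P.natDegree = m + 1 := ⟨P.natDegree - 1, by omega⟩
  obtain ⟨u, g', hg', h'⟩ := exists_mk_divConst_X_pow m b
  refine ⟨u, g' + g, by rw [deg_add]; omega, ?_⟩
  rw [hfg, mk_add, mk_divConst, mk_add, ← add_assoc, ← h']
  simp only [hm]

/-- The sum of the classes of the `X / u`. -/
noncomputable def linSum (l : List kˣ) : NaiveClass k := (l.map lin).sum

theorem linSum_cons (u : kˣ) (l : List kˣ) : linSum (u :: l) = lin u + linSum l := by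
  rw [linSum, List.map_cons, List.sum_cons]; rfl

theorem linSum_nil : linSum ([] : List kˣ) = 0 := rfl

theorem exists_eq_linSum (x : NaiveClass k) : ∃ l : List kˣ, x = linSum l := by
  obtain ⟨f⟩ := x
  change ∃ l : List kˣ, mk f = linSum l
  generalize hn : f.deg = n
  induction n generalizing f with
  | zero => exact ⟨[], by rw [eq_zero_of_deg_eq_zero hn]; rfl⟩
  | succ n ih =>
    obtain ⟨u, g, hg, h⟩ := exists_mk_eq_lin_add f hn
    obtain ⟨l, hl⟩ := ih g hg
    exact ⟨u :: l, by rw [h, hl, linSum_cons]⟩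

end NaiveClass

/-! ## Pointed rational functions of degree two -/

namespace PointedRat

section Ring

variable {R : Type u} [CommRing R]

/-- The pointed rational function of degree two with Bézout matrix `[α, β; β, γ]`, of determinant
`d`, whose coefficients are polynomial in `α`, `β`, `γ` and `d⁻¹`. -/
noncomputable def quad [Nontrivial R] (α β γ : R) (d : Rˣ) (hd : α * γ - β ^ 2 = d) :
    PointedRat R :=
  have hlt : (C (α * β * (↑d⁻¹ : R)) * X + C (α ^ 2 * (↑d⁻¹ : R))).degree < ((2 : ℕ) : WithBot ℕ) :=
    degree_linear_lt
  ofCoprime (X ^ 2 - (C (α * β * (↑d⁻¹ : R)) * X + C (α ^ 2 * (↑d⁻¹ : R)))) (C γ * X + C β)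
    ((monic_X_pow 2).sub_of_left (by rwa [degree_X_pow]))
    (by
      rw [degree_sub_eq_left_of_degree_lt (by rwa [degree_X_pow]), degree_X_pow]
      exact degree_linear_lt)
    (by
      have h1 : C (α * γ - β ^ 2) * C (↑d⁻¹ : R) = 1 := by
        rw [hd, ← C_mul, Units.mul_inv, C_1]
      -- These cofactors express that `γ²` times the numerator is congruent to `-d` modulo `γ X +
      -- β`.
      refine ⟨-(C γ ^ 2 * C (↑d⁻¹ : R)),
        C (↑d⁻¹ : R) * (C γ * X - C β - C (α * β * (↑d⁻¹ : R)) * C γ), ?_⟩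
      simp only [C_mul, C_sub, C_pow] at h1 ⊢
      grind)

end Ring

variable {k : Type u} [Field k]

/-- The coefficients of `quad` are polynomial in the matrix entries and `d⁻¹`, so a path of matrices
with constant determinant specialises compatibly at both ends. -/
theorem homotopy_quad {α β γ : k[X]} {d : kˣ} (h : α * γ - β ^ 2 = C (d : k))
    (h₀ : α.eval 0 * γ.eval 0 - β.eval 0 ^ 2 = d) (h₁ : α.eval 1 * γ.eval 1 - β.eval 1 ^ 2 = d) :
    Homotopy (quad (α.eval 0) (β.eval 0) (γ.eval 0) d h₀)
      (quad (α.eval 1) (β.eval 1) (γ.eval 1) d h₁) := by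
  refine ⟨quad α β γ (Units.map (C : k →+* k[X]).toMonoidHom d) h, PointedRat.ext ?_ ?_,
      PointedRat.ext ?_ ?_⟩ <;>
    simp [quad, ofCoprime, PointedRat.map, -map_inv, -Units.val_inv_eq_inv_val]

end PointedRat

/-! ### Relations between the classes in degree two -/

namespace NaiveClass

open PointedRat

variable {k : Type u} [Field k]

open Classical in
/-- The class of the pointed rational function of degree two with Bézout matrix `[α, β; β, γ]`. -/
noncomputable def quad (α β γ : k) : NaiveClass k :=
  -- With a default value for singular matrices, the entries can be rewritten without carrying a
  -- proof about the determinant.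
  if h : α * γ - β ^ 2 ≠ 0 then mk (PointedRat.quad α β γ (Units.mk0 _ h) rfl) else 0

theorem quad_eq {α β γ : k} (d : kˣ) (h : α * γ - β ^ 2 = d) :
    quad α β γ = mk (PointedRat.quad α β γ d h) := by
  have h0 : α * γ - β ^ 2 ≠ 0 := h ▸ d.ne_zero
  have h1 : d = Units.mk0 _ h0 := Units.ext h.symm
  subst h1
  rw [quad, dif_pos h0]

theorem quad_eval {α β γ : k[X]} {d : k} (hd : d ≠ 0) (h : α * γ - β ^ 2 = C d) :
    quad (α.eval 0) (β.eval 0) (γ.eval 0) = quad (α.eval 1) (β.eval 1) (γ.eval 1) := by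
  have h' : ∀ t : k, α.eval t * γ.eval t - β.eval t ^ 2 = Units.mk0 d hd := fun t => by
    simpa using congrArg (eval t) h
  rw [quad_eq (Units.mk0 d hd) (h' 0), quad_eq (Units.mk0 d hd) (h' 1)]
  exact mk_eq (homotopy_quad (d := Units.mk0 d hd) h (h' 0) (h' 1))

/-- A shear has determinant one and is joined to the identity by scaling its parameter from `0` to
`t`. -/
theorem quad_shear_left {α β γ : k} (hd : α * γ - β ^ 2 ≠ 0) (t : k) :
    quad α β γ = quad (α + 2 * t * β + t ^ 2 * γ) (β + t * γ) γ := by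
  have := quad_eval (α := C α + 2 * C t * X * C β + (C t * X) ^ 2 * C γ)
    (β := C β + C t * X * C γ) (γ := C γ) hd
    (by simp only [C_sub, C_mul, C_pow]; ring)
  simpa using this

theorem quad_shear_right {α β γ : k} (hd : α * γ - β ^ 2 ≠ 0) (t : k) :
    quad α β γ = quad α (β + t * α) (γ + 2 * t * β + t ^ 2 * α) := by
  have := quad_eval (γ := C γ + 2 * C t * X * C β + (C t * X) ^ 2 * C α)
    (β := C β + C t * X * C α) (α := C α) hd
    (by simp only [C_sub, C_mul, C_pow]; ring)
  simpa using this

/-- When `γ = 0` the determinant is `-β²`, independent of `α`, which can therefore be contracted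
linearly to `0`. -/
theorem quad_zero_right {β : k} (hβ : β ≠ 0) (α : k) : quad α β 0 = quad 0 β 0 := by
  have := quad_eval (α := C α * (1 - X)) (β := C β) (γ := 0) (d := - β ^ 2)
    (neg_ne_zero.2 (pow_ne_zero 2 hβ)) (by simp)
  simpa using this

theorem lin_add_lin (u v : kˣ) : lin u + lin v = quad (v : k) 0 u := by
  rw [quad_eq (v * u) (by simp)]
  refine congrArg mk (PointedRat.ext ?_ ?_)
  · rw [num_lin_add]
    have h : (v : k) ^ 2 * (↑(v * u)⁻¹ : k) = (↑u⁻¹ : k) * v := by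
      simp; field_simp
    simp only [PointedRat.quad, ofCoprime, h]
    simp [PointedRat.lin, divConst, ofCoprime, pow_two]
  · rw [den_lin_add]
    simp [PointedRat.lin, divConst, ofCoprime, PointedRat.quad]

/-- Starting from `diag(v, u)`, the shear by `(a - 1) / b` followed by the opposite shear by `b`
carries the second basis vector to `(b, a)`, whose value is `u a² + v b²`. -/
theorem lin_add_lin_eq_quad (u v : kˣ) {a b : k} (hb : b ≠ 0) :
    lin u + lin v = quad (v + ((a - 1) / b) ^ 2 * u) ((u * a ^ 2 + v * b ^ 2 - u * a) / b)
      (u * a ^ 2 + v * b ^ 2) := by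
  have h0 : (v : k) * u - 0 ^ 2 ≠ 0 := by simp
  rw [lin_add_lin, quad_shear_left h0 ((a - 1) / b), quad_shear_right ?_ b]
  · congr 1 <;> field_simp <;> ring
  · convert h0 using 1; ring

/-- Once `c` is a diagonal entry, a further shear clears the off-diagonal entry; the determinant
`uv` forces the other diagonal entry to be `uv / c`. -/
theorem lin_add_lin_of_eq (u v c : kˣ) {a b : k} (hb : b ≠ 0)
    (hc : (c : k) = u * a ^ 2 + v * b ^ 2) : lin u + lin v = lin c + lin (u * v / c) := by
  rw [lin_add_lin_eq_quad u v hb, ← hc, lin_add_lin,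
    quad_shear_left ?_ (-((c - u * a) / b) / c)]
  · congr 1
    · rw [Units.val_div_eq_div_val, Units.val_mul]
      have := c.ne_zero
      field_simp
      rw [hc]; ring
    · have := c.ne_zero
      field_simp
      ring
  · have h0 : (u : k) * v ≠ 0 := by simp
    convert h0 using 1
    field_simp
    rw [hc]; ring

theorem lin_add_comm (u v : kˣ) : lin u + lin v = lin v + lin u := by
  have := lin_add_lin_of_eq u v v (a := 0) one_ne_zero (by simp)
  rwa [mul_div_cancel_right] at this

/-- The relation given by a non-zero value of a binary form. -/
theorem lin_add_lin_of_repr (u v c : kˣ) {a b : k} (hc : (c : k) = u * a ^ 2 + v * b ^ 2) :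
    lin u + lin v = lin c + lin (u * v / c) := by
  rcases eq_or_ne b 0 with rfl | hb
  · have ha : a ≠ 0 := by
      rintro rfl
      simp at hc
    rw [lin_add_comm, mul_comm u]
    exact lin_add_lin_of_eq v u c ha (by rw [hc, add_comm])
  · exact lin_add_lin_of_eq u v c hb hc

/-- The relation given by an isotropic vector of a binary form. -/
theorem lin_add_lin_of_isotropic (u v : kˣ) {a b : k} (hb : b ≠ 0)
    (h : (u : k) * a ^ 2 + v * b ^ 2 = 0) : lin u + lin v = lin 1 + lin (u * v) := by
  have ha : a ≠ 0 := by
    rintro rfl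
    simp [hb] at h
  have key : ∀ (u v : kˣ) {a b : k}, a ≠ 0 → b ≠ 0 → (u : k) * a ^ 2 + v * b ^ 2 = 0 →
      lin u + lin v = quad 0 (-(u * a / b)) 0 := fun u v a b ha hb h => by
    rw [lin_add_lin_eq_quad u v hb, h, zero_sub, neg_div]
    exact quad_zero_right (by simp [ha, hb]) _
  -- The isotropic vector `(ua/b, 1)` of `⟨1, uv⟩` is chosen so that both binary forms reach the
  -- same off-diagonal entry `-(ua/b)`.
  rw [key u v ha hb h, key 1 (u * v) (a := u * a / b) (b := 1) (by simp [ha, hb]) one_ne_zero ?_]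
  · simp
  · simp only [Units.val_one, Units.val_mul]
    field_simp
    linear_combination (u : k) * h

end NaiveClass

/-! ## Congruence of symmetric matrices -/

namespace Matrix

section Cong

variable {R : Type*} [CommRing R] {ι κ μ : Type*} [Fintype ι] [Fintype κ] [Fintype μ]
  [DecidableEq ι] [DecidableEq κ] [DecidableEq μ]

/-- Congruence of square matrices, possibly indexed by different types. -/
def Cong (M : Matrix ι ι R) (N : Matrix κ κ R) : Prop :=
  ∃ (P : Matrix ι κ R) (Q : Matrix κ ι R), P * Q = 1 ∧ Q * P = 1 ∧ N = Pᵀ * M * P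

theorem Cong.trans {M : Matrix ι ι R} {N : Matrix κ κ R} {O : Matrix μ μ R} (h : Cong M N)
    (h' : Cong N O) : Cong M O := by
  obtain ⟨P, Q, h1, h2, rfl⟩ := h
  obtain ⟨P', Q', h1', h2', rfl⟩ := h'
  refine ⟨P * P', Q' * Q, ?_, ?_, ?_⟩
  · rw [Matrix.mul_assoc, ← Matrix.mul_assoc P', h1', Matrix.one_mul, h1]
  · rw [Matrix.mul_assoc, ← Matrix.mul_assoc Q, h2, Matrix.one_mul, h2']
  · simp only [transpose_mul, Matrix.mul_assoc]

theorem cong_submatrix (M : Matrix ι ι R) (e : κ ≃ ι) : Cong M (M.submatrix e e) := by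
  refine ⟨(1 : Matrix ι ι R).submatrix id e, (1 : Matrix ι ι R).submatrix e id, ?_, ?_, ?_⟩
  · rw [submatrix_mul_equiv, Matrix.one_mul, submatrix_id_id]
  · rw [← submatrix_mul _ _ e id e Function.bijective_id, Matrix.one_mul,
      submatrix_one_equiv]
  · ext i j
    simp [mul_apply, one_apply]

theorem Cong.map {S : Type*} [CommRing S] (φ : R →+* S) {M : Matrix ι ι R} {N : Matrix κ κ R}
    (h : Cong M N) : Cong (M.map φ) (N.map φ) := by
  obtain ⟨P, Q, h1, h2, rfl⟩ := h
  refine ⟨P.map φ, Q.map φ, ?_, ?_, ?_⟩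
  · rw [← Matrix.map_mul, h1, Matrix.map_one _ (map_zero φ) (map_one φ)]
  · rw [← Matrix.map_mul, h2, Matrix.map_one _ (map_zero φ) (map_one φ)]
  · rw [Matrix.map_mul, Matrix.map_mul, transpose_map]

theorem Cong.isSymm {M : Matrix ι ι R} {N : Matrix κ κ R} (h : Cong M N) (hM : M.IsSymm) :
    N.IsSymm := by
  obtain ⟨P, Q, h1, h2, rfl⟩ := h
  rw [IsSymm, transpose_mul, transpose_mul, transpose_transpose, hM.eq, Matrix.mul_assoc]

theorem Cong.isUnit_det {M : Matrix ι ι R} {N : Matrix κ κ R} (h : Cong M N)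
    (hM : IsUnit M.det) : IsUnit N.det := by
  obtain ⟨P, Q, h1, h2, rfl⟩ := h
  refine isUnit_det_of_right_inverse (B := Q * M⁻¹ * Qᵀ) ?_
  calc Pᵀ * M * P * (Q * M⁻¹ * Qᵀ) = Pᵀ * (M * (P * Q) * M⁻¹) * Qᵀ := by
        simp only [Matrix.mul_assoc]
    _ = (Q * P)ᵀ := by
        rw [h1, Matrix.mul_one, mul_nonsing_inv _ hM, Matrix.mul_one, transpose_mul]
    _ = 1 := by rw [h2, transpose_one]

/-- An invertible diagonal block of a symmetric matrix splits off. -/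
theorem cong_fromBlocks (A : Matrix ι ι R) (B : Matrix ι κ R) (D : Matrix κ κ R)
    (hA : A.IsSymm) (hu : IsUnit A.det) :
    Cong (fromBlocks A B Bᵀ D) (fromBlocks A 0 0 (D - Bᵀ * A⁻¹ * B)) := by
  refine ⟨fromBlocks 1 (-(A⁻¹ * B)) 0 1, fromBlocks 1 (A⁻¹ * B) 0 1, ?_, ?_, ?_⟩
  · simp [fromBlocks_multiply]
  · simp [fromBlocks_multiply]
  · have h1 : (A⁻¹)ᵀ = A⁻¹ := by rw [transpose_nonsing_inv, hA.eq]
    have h2 : A * (A⁻¹ * B) = B := by rw [← Matrix.mul_assoc, mul_nonsing_inv _ hu, Matrix.one_mul]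
    have h3 : Bᵀ * A⁻¹ * A = Bᵀ := by rw [Matrix.mul_assoc, nonsing_inv_mul _ hu, Matrix.mul_one]
    simp [fromBlocks_transpose, fromBlocks_multiply, h1, h2, h3, Matrix.mul_assoc, sub_eq_add_neg,
      add_comm]

omit [DecidableEq ι] [DecidableEq κ] in
theorem dotProduct_cong (P : Matrix ι κ R) (M : Matrix ι ι R) (y : κ → R) :
    y ⬝ᵥ (Pᵀ * M * P) *ᵥ y = (P *ᵥ y) ⬝ᵥ M *ᵥ (P *ᵥ y) := by
  rw [← mulVec_mulVec, ← mulVec_mulVec, dotProduct_mulVec, vecMul_transpose]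

/-- A vector over a principal ideal domain is a multiple of the first vector of some basis. -/
theorem exists_first_column [IsDomain R] [IsPrincipalIdealRing R] {n : ℕ} (x : Fin (n + 1) → R)
    (hx : x ≠ 0) : ∃ (P Q : Matrix (Fin (n + 1)) (Fin (n + 1)) R) (a : R),
      P * Q = 1 ∧ Q * P = 1 ∧ x = a • P.col 0 := by
  -- The Smith normal form of the line spanned by `x` expresses a generator as a multiple of one
  -- vector of a basis of the whole module.
  obtain ⟨m, bM, bN, f, a, snf⟩ := Submodule.smithNormalForm (Pi.basisFun R (Fin (n + 1)))
    (Submodule.span R {x})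
  have hm : m = 1 := by
    have h1 := Module.finrank_eq_card_basis bN
    rw [← (LinearEquiv.toSpanNonzeroSingleton R _ x hx).finrank_eq, Module.finrank_self,
      Fintype.card_fin] at h1
    exact h1.symm
  subst hm
  have h2 := congrArg Subtype.val (bN.sum_repr ⟨x, Submodule.mem_span_singleton_self x⟩)
  rw [Fin.sum_univ_one] at h2
  set e := bM.reindex (Equiv.swap (f 0) 0) with he
  have he0 : e 0 = bM (f 0) := by simp [he]
  refine ⟨(Pi.basisFun R (Fin (n + 1))).toMatrix e, e.toMatrix (Pi.basisFun R (Fin (n + 1))),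
    bN.repr ⟨x, Submodule.mem_span_singleton_self x⟩ 0 * a 0,
    Module.Basis.toMatrix_mul_toMatrix_flip _ _, Module.Basis.toMatrix_mul_toMatrix_flip _ _, ?_⟩
  have h3 : ((Pi.basisFun R (Fin (n + 1))).toMatrix e).col 0 = e 0 := by
    ext i; simp [Module.Basis.toMatrix_apply]
  rw [h3, he0, mul_smul, ← snf]
  exact h2.symm

end Cong

/-! ### Degrees of values and of determinants over `k[X]` -/

section Degree

variable {k : Type*} [Field k]

/-- This is elimination of the first column without division: left multiplication by a triangular
matrix with diagonal `(1, p, …, p)`, where `p` is the pivot. Avoiding division makes it valid over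
any commutative ring. -/
theorem det_first_pivot {R : Type*} [CommRing R] {n : ℕ}
    (M : Matrix (Fin (n + 1)) (Fin (n + 1)) R) :
    M 0 0 * (Matrix.of fun i j : Fin n =>
      M 0 0 * M i.succ j.succ - M i.succ 0 * M 0 j.succ).det = M 0 0 ^ n * M.det := by
  set L : Matrix (Fin (n + 1)) (Fin (n + 1)) R := Matrix.of fun i j =>
    Fin.cases (Fin.cases 1 (fun _ => 0) j)
      (fun i' => Fin.cases (-M i'.succ 0) (fun j' => (M 0 0 • (1 : Matrix (Fin n) (Fin n) R)) i' j')
        j) i with hL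
  have hdet : L.det = M 0 0 ^ n := by
    rw [det_succ_row_zero, Fin.sum_univ_succ]
    have h0 : L.submatrix Fin.succ Fin.succ = M 0 0 • (1 : Matrix (Fin n) (Fin n) R) := by
      ext i j; simp [hL]
    have h1 : L 0 0 = 1 := by simp [hL]
    have h2 : ∀ i : Fin n, L 0 i.succ = 0 := fun i => by simp [hL]
    simp [h0, h1, h2]
  rw [← hdet, ← det_mul, det_succ_column_zero, Fin.sum_univ_succ]
  have h0 : (L * M) 0 0 = M 0 0 := by simp [mul_apply, Fin.sum_univ_succ, hL]
  have h1 : ∀ i : Fin n, (L * M) i.succ 0 = 0 := fun i => by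
    simp [mul_apply, Fin.sum_univ_succ, hL, one_apply, mul_comm]
  simp only [h1, h0]
  simp only [Fin.val_zero, pow_zero, one_mul, mul_zero, zero_mul, Finset.sum_const_zero, add_zero,
    Fin.succAbove_zero]
  congr 2
  ext i j
  simp [mul_apply, Fin.sum_univ_succ, hL, one_apply]
  ring

/-- The value at `(t, z)` of a form, multiplied by its first coefficient `p`, is the value at `z`
of the form of `Matrix.det_first_pivot`, up to a square. -/
theorem first_pivot_value {R : Type*} [CommRing R] {n : ℕ}
    {M : Matrix (Fin (n + 1)) (Fin (n + 1)) R} (hM : M.IsSymm) (t : R) (z : Fin n → R) :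
    z ⬝ᵥ (Matrix.of fun i j : Fin n => M 0 0 * M i.succ j.succ - M i.succ 0 * M 0 j.succ) *ᵥ z =
      M 0 0 * ((Fin.cons t z : Fin (n + 1) → R) ⬝ᵥ M *ᵥ (Fin.cons t z : Fin (n + 1) → R)) -
        (t * M 0 0 + ∑ j, M 0 j.succ * z j) ^ 2 := by
  have hs : ∀ i : Fin n, M i.succ 0 = M 0 i.succ := fun i => hM.apply _ _
  have h1 : ∀ i : Fin n, ((Matrix.of fun i j : Fin n =>
      M 0 0 * M i.succ j.succ - M i.succ 0 * M 0 j.succ) *ᵥ z) i =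
      M 0 0 * (∑ j, M i.succ j.succ * z j) - M 0 i.succ * ∑ j, M 0 j.succ * z j := fun i => by
    simp only [mulVec, dotProduct, of_apply, Finset.mul_sum, ← Finset.sum_sub_distrib, hs]
    exact Finset.sum_congr rfl fun j _ => by ring
  have h2 : ∀ i : Fin (n + 1), (M *ᵥ (Fin.cons t z : Fin (n + 1) → R)) i =
      M i 0 * t + ∑ j, M i j.succ * z j := fun i => by
    simp [mulVec, dotProduct, Fin.sum_univ_succ]
  rw [dotProduct, Finset.sum_congr rfl fun i _ => congrArg (z i * ·) (h1 i)]
  simp only [dotProduct, h2, Fin.sum_univ_succ, Fin.cons_zero, Fin.cons_succ, hs, mul_sub,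
    mul_add, Finset.sum_sub_distrib, Finset.sum_add_distrib]
  have h3 : ∑ i, z i * (M 0 0 * ∑ j, M i.succ j.succ * z j) =
      M 0 0 * ∑ i, z i * ∑ j, M i.succ j.succ * z j := by
    rw [Finset.mul_sum]; exact Finset.sum_congr rfl fun j _ => by ring
  have h4 : ∑ i, z i * (M 0 i.succ * ∑ j, M 0 j.succ * z j) =
      (∑ j, M 0 j.succ * z j) * ∑ j, M 0 j.succ * z j := by
    rw [Finset.sum_mul]; exact Finset.sum_congr rfl fun j _ => by ring
  have h5 : ∑ i, z i * (M 0 i.succ * t) = t * ∑ j, M 0 j.succ * z j := by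
    rw [Finset.mul_sum]; exact Finset.sum_congr rfl fun j _ => by ring
  rw [h3, h4, h5]
  ring

/-- An anisotropic form over `k[X]` takes a value of minimal degree at the first vector of some
basis. -/
theorem exists_minimal_column {n : ℕ} (M : Matrix (Fin (n + 1)) (Fin (n + 1)) k[X])
    (h : ∀ x, x ≠ 0 → x ⬝ᵥ M *ᵥ x ≠ 0) :
    ∃ P Q : Matrix (Fin (n + 1)) (Fin (n + 1)) k[X], P * Q = 1 ∧ Q * P = 1 ∧
      (Pᵀ * M * P) 0 0 ≠ 0 ∧ ∀ x, x ≠ 0 → ((Pᵀ * M * P) 0 0).natDegree ≤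
        (x ⬝ᵥ M *ᵥ x).natDegree := by
  obtain ⟨x, hx, hmin⟩ := (measure fun x : Fin (n + 1) → k[X] =>
    (x ⬝ᵥ M *ᵥ x).natDegree).wf.has_min {x | x ≠ 0} ⟨1, one_ne_zero⟩
  obtain ⟨P, Q, a, h1, h2, hxP⟩ := exists_first_column x hx
  have hP : (Pᵀ * M * P) 0 0 = P.col 0 ⬝ᵥ M *ᵥ P.col 0 := by
    rw [← Matrix.mulVec_single_one, ← dotProduct_cong]
    simp
  -- The value at the column divides the minimal value at `x`, so its degree is also a lower bound
  -- for all values.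
  have hxx : x ⬝ᵥ M *ᵥ x = a ^ 2 * (Pᵀ * M * P) 0 0 := by
    rw [hP, hxP, mulVec_smul, smul_dotProduct, dotProduct_smul, smul_eq_mul, smul_eq_mul]; ring
  have h0 := h x hx
  rw [hxx] at h0
  refine ⟨P, Q, h1, h2, right_ne_zero_of_mul h0, fun y hy => ?_⟩
  have h3 := hmin y hy
  change ¬ (y ⬝ᵥ M *ᵥ y).natDegree < (x ⬝ᵥ M *ᵥ x).natDegree at h3
  rw [hxx, natDegree_mul (left_ne_zero_of_mul h0) (right_ne_zero_of_mul h0)] at h3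
  omega

/-- If the non-zero values of a symmetric matrix of polynomials of size `n` have degree at least
`d`, then its determinant has degree at least `n * d`. -/
theorem mul_le_natDegree_det (n : ℕ) : ∀ (d : ℕ) (M : Matrix (Fin n) (Fin n) k[X]), M.IsSymm →
    (∀ x, x ≠ 0 → x ⬝ᵥ M *ᵥ x ≠ 0 ∧ d ≤ (x ⬝ᵥ M *ᵥ x).natDegree) →
    M.det ≠ 0 ∧ n * d ≤ M.det.natDegree := by
  induction n with
  | zero => intro d M _ _; simp
  | succ n ih =>
    intro d M hM h
    obtain ⟨P, Q, h1, h2, h0, hmin⟩ := exists_minimal_column M fun x hx => (h x hx).1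
    have hcong : Cong M (Pᵀ * M * P) := ⟨P, Q, h1, h2, rfl⟩
    have hinj : ∀ x, x ≠ 0 → P *ᵥ x ≠ 0 := fun x hx hPx => hx (by
      rw [← one_mulVec x, ← h2, ← mulVec_mulVec, hPx, mulVec_zero])
    have hdet : (Pᵀ * M * P).det = M.det * P.det ^ 2 := by
      rw [det_mul, det_mul, det_transpose]; ring
    have hPu : IsUnit P.det := isUnit_det_of_right_inverse h1
    set N := Pᵀ * M * P with hN
    have hNs := hcong.isSymm hM
    have hval : ∀ x, x ≠ 0 → x ⬝ᵥ N *ᵥ x ≠ 0 ∧ (N 0 0).natDegree ≤ (x ⬝ᵥ N *ᵥ x).natDegree :=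
      fun x hx => by
        rw [hN, dotProduct_cong]
        exact ⟨(h _ (hinj x hx)).1, hmin _ (hinj x hx)⟩
    have hd : d ≤ (N 0 0).natDegree := by
      have h3 := (h (P *ᵥ Pi.single 0 1) (hinj _ (by simp))).2
      rw [← dotProduct_cong] at h3
      simpa using h3
    -- With `e` the degree of the pivot `p`, the eliminated form takes values of degree at least
    -- `2e`. Comparing degrees in `p · det' = pⁿ · det N` gives `e + 2ne ≤ ne + deg det N`.
    have key := ih (2 * (N 0 0).natDegree)
      (Matrix.of fun i j : Fin n => N 0 0 * N i.succ j.succ - N i.succ 0 * N 0 j.succ)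
      (by
        ext i j
        rw [transpose_apply, of_apply, of_apply, hNs.apply i.succ j.succ, hNs.apply 0 j.succ,
          hNs.apply i.succ 0]
        ring_nf) (fun z hz => ?_)
    · have hp := det_first_pivot N
      have hN0 : N.det ≠ 0 := fun h0' => by
        rw [h0', mul_zero] at hp
        exact mul_ne_zero h0 key.1 hp
      have hdeg := congrArg natDegree hp
      rw [natDegree_mul h0 key.1, natDegree_mul (pow_ne_zero _ h0) hN0, natDegree_pow] at hdeg
      rw [hdet] at hN0 hdeg
      rw [natDegree_mul (left_ne_zero_of_mul hN0) (right_ne_zero_of_mul hN0), natDegree_pow,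
        natDegree_eq_zero_of_isUnit hPu] at hdeg
      refine ⟨left_ne_zero_of_mul hN0, ?_⟩
      have := key.2
      calc (n + 1) * d ≤ (n + 1) * (N 0 0).natDegree := Nat.mul_le_mul_left _ hd
        _ ≤ M.det.natDegree := by linarith
    -- The free coordinate `t` is minus the Euclidean quotient of `r` by the pivot. The squared term
    -- is then a square of a remainder, of degree too small to cancel the pivot times the value at
    -- `(t, z)`.
    · set r := ∑ j, N 0 j.succ * z j with hr
      have hy : (Fin.cons (-(r / N 0 0)) z : Fin (n + 1) → k[X]) ≠ 0 := fun h0 => hz (by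
        ext1 i; simpa using congrFun h0 i.succ)
      rw [first_pivot_value hNs (-(r / N 0 0)) z, ← hr]
      obtain ⟨h3, h4⟩ := hval _ hy
      set w := (Fin.cons (-(r / N 0 0)) z : Fin (n + 1) → k[X]) ⬝ᵥ
        N *ᵥ (Fin.cons (-(r / N 0 0)) z : Fin (n + 1) → k[X])
      have hs : -(r / N 0 0) * N 0 0 + r = r % N 0 0 := by
        have := EuclideanDomain.div_add_mod r (N 0 0)
        linear_combination -this
      rw [hs]
      have hlt : ((r % N 0 0) ^ 2).degree < (N 0 0 * w).degree := by
        rw [pow_two, degree_mul, degree_mul]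
        have h5 : (r % N 0 0).degree < (N 0 0).degree := EuclideanDomain.mod_lt r h0
        have h6 : (N 0 0).degree ≤ w.degree := by
          rw [degree_eq_natDegree h0, degree_eq_natDegree h3]
          exact_mod_cast h4
        refine (add_le_add_right h5.le _).trans_lt ?_
        rw [add_comm]
        exact (WithBot.add_lt_add_left (by simpa using h0) (h5.trans_le h6))
      have h7 := degree_sub_eq_left_of_degree_lt hlt
      refine ⟨fun h8 => ?_, ?_⟩
      · rw [h8, degree_zero, eq_comm, degree_eq_bot] at h7
        exact mul_ne_zero h0 h3 h7
      · rw [natDegree_eq_of_degree_eq h7, natDegree_mul h0 h3]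
        omega

end Degree
end Matrix

/-! ## Stable isometry classes of symmetric matrices -/

/-- The non-degenerate symmetric bilinear form with a given Gram matrix. -/
noncomputable def NDForm.ofMatrix {k : Type u} [Field k] {ι : Type} [Fintype ι] [DecidableEq ι]
    (M : Matrix ι ι k) (hM : M.IsSymm) (hd : M.det ≠ 0) : NDForm k where
  V := ι → k
  form := Matrix.toBilin' M
  symm := Matrix.isSymm_toBilin'_iff_isSymm.2 hM
  nondegenerate := LinearMap.BilinForm.nondegenerate_toBilin'_iff_det_ne_zero.2 hd

/-- The form of rank one with Gram matrix `(u)`. -/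
noncomputable def NDForm.unary {k : Type u} [Field k] (u : kˣ) : NDForm k where
  V := k
  form := (u : k) • LinearMap.mul k k
  symm := ⟨fun x y => by simp [mul_comm]⟩
  nondegenerate := by
    constructor
    · intro x hx
      simpa using hx 1
    · intro x hx
      simpa using hx 1

theorem NDForm.unary_apply {k : Type u} [Field k] (u : kˣ) (x y : k) :
    (NDForm.unary u).form x y = u * (x * y) := rfl

namespace MWs

open Matrix

variable {k : Type u} [Field k]

theorem mk_eq {b c : NDForm k} (h : NDForm.Isometric b c) : mk b = mk c :=
  congrArg ((↑) : MW k → MWs k) (Quotient.sound h : MW.mk b = MW.mk c)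

theorem mk_add (b c : NDForm k) : mk (b + c) = mk b + mk c := rfl

theorem mk_zero : mk (0 : NDForm k) = 0 := rfl

/-- The summand to be cancelled is absorbed into the auxiliary form of the stable isometry. -/
theorem add_cancel_left {x y z : MWs k} (h : z + x = z + y) : x = y := by
  induction x using AddCon.induction_on with | _ x
  induction y using AddCon.induction_on with | _ y
  induction z using AddCon.induction_on with | _ z
  obtain ⟨d, hd⟩ := (AddCon.eq _).1 h
  exact (AddCon.eq _).2 ⟨z + d, by rwa [add_left_comm, ← add_assoc, add_left_comm y, ← add_assoc]⟩

/-- Two forms are stably isometric exactly when they have the same class. -/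
theorem mk_eq_iff {b c : NDForm k} :
    mk b = mk c ↔ ∃ d : NDForm k, NDForm.Isometric (b + d) (c + d) := by
  constructor
  · intro h
    obtain ⟨⟨d⟩, hd⟩ := (AddCon.eq _).1 h
    exact ⟨d, Quotient.exact hd⟩
  · rintro ⟨d, hd⟩
    exact (AddCon.eq _).2 ⟨MW.mk d, Quotient.sound hd⟩

/-- The class of a form of rank one. -/
noncomputable def unary (u : kˣ) : MWs k := mk (NDForm.unary u)

section OfMatrix

variable {ι κ : Type} [Fintype ι] [DecidableEq ι] [Fintype κ] [DecidableEq κ]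

open Classical in
/-- The stable isometry class of the form with Gram matrix `M`. -/
noncomputable def ofMatrix (M : Matrix ι ι k) : MWs k :=
  if h : M.IsSymm ∧ M.det ≠ 0 then mk (NDForm.ofMatrix M h.1 h.2) else 0

theorem ofMatrix_eq {M : Matrix ι ι k} (hM : M.IsSymm) (hd : M.det ≠ 0) :
    ofMatrix M = mk (NDForm.ofMatrix M hM hd) := dif_pos ⟨hM, hd⟩

theorem ofMatrix_cong {M : Matrix ι ι k} {N : Matrix κ κ k} (h : Cong M N) (hM : M.IsSymm)
    (hd : M.det ≠ 0) : ofMatrix M = ofMatrix N := by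
  have hN := h.isSymm hM
  have hNd := (h.isUnit_det hd.isUnit).ne_zero
  rw [ofMatrix_eq hM hd, ofMatrix_eq hN hNd]
  obtain ⟨P, Q, h1, h2, rfl⟩ := h
  have key : ∀ x y, toBilin' M (P *ᵥ x) (P *ᵥ y) = toBilin' (Pᵀ * M * P) x y := fun x y => by
    rw [toBilin'_apply', toBilin'_apply', ← mulVec_mulVec, ← mulVec_mulVec, dotProduct_mulVec x,
      vecMul_transpose]
  exact (mk_eq ⟨toLin'OfInv h2 h1, key⟩).symm

omit [Fintype ι] [Fintype κ] [DecidableEq ι] [DecidableEq κ] in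
theorem isSymm_fromBlocks {R : Type*} [CommRing R] {M : Matrix ι ι R} {N : Matrix κ κ R}
    (hM : M.IsSymm) (hN : N.IsSymm) : (fromBlocks M 0 0 N).IsSymm := by
  rw [IsSymm, fromBlocks_transpose, hM.eq, hN.eq, transpose_zero, transpose_zero]

theorem ofMatrix_fromBlocks {M : Matrix ι ι k} {N : Matrix κ κ k} (hM : M.IsSymm) (hN : N.IsSymm)
    (hMd : M.det ≠ 0) (hNd : N.det ≠ 0) :
    ofMatrix (fromBlocks M 0 0 N) = ofMatrix M + ofMatrix N := by
  rw [ofMatrix_eq hM hMd, ofMatrix_eq hN hNd, ← mk_add, ofMatrix_eq (isSymm_fromBlocks hM hN)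
    (by rw [det_fromBlocks_zero₂₁]; exact mul_ne_zero hMd hNd)]
  have key : ∀ x y : ι ⊕ κ → k, toBilin' M (x ∘ Sum.inl) (y ∘ Sum.inl) +
      toBilin' N (x ∘ Sum.inr) (y ∘ Sum.inr) = toBilin' (fromBlocks M 0 0 N) x y := fun x y => by
    rw [toBilin'_apply', toBilin'_apply', toBilin'_apply', fromBlocks_mulVec]
    simp [dotProduct, Fintype.sum_sum_type]
  exact mk_eq ⟨LinearEquiv.sumArrowLequivProdArrow ι κ k k, key⟩

theorem ofMatrix_unary (u : kˣ) : ofMatrix (of fun _ _ : Fin 1 => (u : k)) = unary u := by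
  rw [ofMatrix_eq (by ext; rfl) (by simp)]
  have key : ∀ x y : Fin 1 → k, (u : k) * (x 0 * y 0) =
      toBilin' (of fun _ _ : Fin 1 => (u : k)) x y := fun x y => by
    rw [toBilin'_apply']
    simp [dotProduct, mulVec]
    ring
  exact mk_eq ⟨LinearEquiv.funUnique (Fin 1) k k, key⟩

theorem isSymm_hyperbolic {R : Type*} [CommRing R] (v c : R) : (!![0, v; v, c]).IsSymm := by
  ext i j; fin_cases i <;> fin_cases j <;> rfl

/-- Adding `⟨-c⟩` makes the planes isometric. This stabilisation is essential in characteristic 2,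
where for `c ≠ 0` only one of the planes is alternating. -/
theorem ofMatrix_hyperbolic {v : k} (hv : v ≠ 0) (c : k) :
    ofMatrix !![0, v; v, c] = ofMatrix !![0, v; v, 0] := by
  have hd : ∀ c, (!![0, v; v, c] : Matrix _ _ k).det ≠ 0 := fun c => by simp [hv]
  rcases eq_or_ne c 0 with rfl | hc
  · rfl
  have hs : ∀ a : k, (of fun _ _ : Fin 1 => a).IsSymm := fun a => rfl
  have key : Cong (fromBlocks !![0, v; v, c] 0 0 (of fun _ _ : Fin 1 => -c))
      (fromBlocks !![0, v; v, 0] 0 0 (of fun _ _ : Fin 1 => -c)) := by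
    -- With `f` the vector of value `-c`, the new basis is `e₁`, `e₂ + f`, `f + (c/v) e₁`: the
    -- vector `e₂ + f` is isotropic, and the correction of `f` restores orthogonality.
    refine ⟨fromBlocks 1 !![c / v; 0] !![0, 1] 1,
      fromBlocks !![1, c / v; 0, 1] !![-c / v; 0] !![0, -1] 1, ?_, ?_, ?_⟩
    · ext i j
      rcases i with i | i <;> rcases j with j | j <;> fin_cases i <;> fin_cases j <;>
        simp [fromBlocks_multiply, neg_div]
    · ext i j
      rcases i with i | i <;> rcases j with j | j <;> fin_cases i <;> fin_cases j <;>
        simp [fromBlocks_multiply, neg_div]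
    · ext i j
      rcases i with i | i <;> rcases j with j | j <;> fin_cases i <;> fin_cases j <;>
        simp [fromBlocks_multiply, fromBlocks_transpose, mul_apply, hv, mul_div_cancel₀]
  have h1 : (of fun _ _ : Fin 1 => -c).det ≠ 0 := by simp [hc]
  have h2 := ofMatrix_fromBlocks (isSymm_hyperbolic v c) (hs (-c)) (hd c) h1
  have h3 := ofMatrix_fromBlocks (isSymm_hyperbolic v 0) (hs (-c)) (hd 0) h1
  have h4 := ofMatrix_cong key
    (isSymm_fromBlocks (isSymm_hyperbolic v c) (hs _))
    (by rw [det_fromBlocks_zero₂₁]; exact mul_ne_zero (hd c) h1)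
  rw [h2, h3, add_comm, add_comm (ofMatrix !![0, v; v, 0])] at h4
  exact add_cancel_left h4

end OfMatrix
end MWs

/-! ## Specialisations of a unimodular symmetric matrix of polynomials -/

namespace Matrix

section PID

variable {R : Type*} [CommRing R]

theorem exists_cong_fromBlocks {ι κ : Type*} [Fintype ι] [DecidableEq ι] [Fintype κ]
    [DecidableEq κ] {N : Matrix (ι ⊕ κ) (ι ⊕ κ) R} (hN : N.IsSymm) (hu : IsUnit N.det)
    (hA : IsUnit N.toBlocks₁₁.det) :
    ∃ D : Matrix κ κ R, D.IsSymm ∧ IsUnit D.det ∧ Cong N (fromBlocks N.toBlocks₁₁ 0 0 D) := by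
  have hAs : N.toBlocks₁₁.IsSymm := hN.submatrix Sum.inl
  have hB : N.toBlocks₂₁ = N.toBlocks₁₂ᵀ := by ext1 i j; exact hN.apply _ _
  have hN' := N.fromBlocks_toBlocks
  rw [hB] at hN'
  have key := cong_fromBlocks N.toBlocks₁₁ N.toBlocks₁₂ N.toBlocks₂₂ hAs hA
  rw [hN'] at key
  refine ⟨_, (key.isSymm hN).submatrix Sum.inr, ?_, key⟩
  have := key.isUnit_det hu
  rw [det_fromBlocks_zero₂₁] at this
  exact isUnit_of_mul_isUnit_right this

/-- The decomposition of `Fin (n + 1)` into `0` and the successors. -/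
def finOneSum (n : ℕ) : Fin 1 ⊕ Fin n ≃ Fin (n + 1) :=
  finSumFinEquiv.trans (finCongr (add_comm 1 n))

theorem finOneSum_inl {n : ℕ} (i : Fin 1) : finOneSum n (Sum.inl i) = 0 := by
  rw [Subsingleton.elim i 0]; ext; simp [finOneSum]

theorem finOneSum_inr {n : ℕ} (i : Fin n) : finOneSum n (Sum.inr i) = i.succ := by
  ext; simp [finOneSum]

variable [IsDomain R] [IsPrincipalIdealRing R]

theorem exists_cong_of_ne_zero {n : ℕ} (M : Matrix (Fin (n + 1)) (Fin (n + 1)) R)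
    {x : Fin (n + 1) → R} (hx : x ≠ 0) :
    ∃ (N : Matrix (Fin (n + 1)) (Fin (n + 1)) R) (a : R), a ≠ 0 ∧ Cong M N ∧
      x ⬝ᵥ M *ᵥ x = a ^ 2 * N 0 0 := by
  obtain ⟨P, Q, a, h1, h2, hxP⟩ := exists_first_column x hx
  refine ⟨Pᵀ * M * P, a, ?_, ⟨P, Q, h1, h2, rfl⟩, ?_⟩
  · rintro rfl
    exact hx (by rw [hxP, zero_smul])
  · have h3 : (Pᵀ * M * P) 0 0 = P.col 0 ⬝ᵥ M *ᵥ P.col 0 := by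
      rw [← Matrix.mulVec_single_one, ← dotProduct_cong]
      simp
    rw [h3, hxP, mulVec_smul, smul_dotProduct, dotProduct_smul, smul_eq_mul, smul_eq_mul]
    ring

/-- An isotropic vector of a unimodular symmetric matrix over a principal ideal domain lies in a
unimodular plane. -/
theorem exists_cong_of_isotropic {n : ℕ} {M : Matrix (Fin (n + 1)) (Fin (n + 1)) R}
    (hM : M.IsSymm) (hu : IsUnit M.det) {x : Fin (n + 1) → R} (hx : x ≠ 0)
    (hx0 : x ⬝ᵥ M *ᵥ x = 0) :
    ∃ (m : ℕ) (N : Matrix (Fin 2 ⊕ Fin m) (Fin 2 ⊕ Fin m) R) (v c : R), m < n ∧ IsUnit v ∧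
      Cong M N ∧ N.toBlocks₁₁ = !![0, v; v, c] := by
  obtain ⟨N, a, ha, hcong, hN⟩ := exists_cong_of_ne_zero M hx
  have hP : N 0 0 = 0 := by
    rw [hN] at hx0
    simpa [ha] using hx0
  have hNs := hcong.isSymm hM
  have hNu := hcong.isUnit_det hu
  -- The first row of an invertible matrix is unimodular. Since its first entry vanishes, the
  -- remaining entries already generate the unit ideal.
  have hinv : ∑ j : Fin n, N 0 j.succ * N⁻¹ j.succ 0 = 1 := by
    have := congrFun (congrFun (mul_nonsing_inv N hNu) 0) 0
    rwa [mul_apply, Fin.sum_univ_succ, hP, zero_mul, zero_add, one_apply_eq] at this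
  rcases n with - | n
  · simp at hinv
  -- The vector pairing to `1` with the isotropic one is a multiple `a'` of a basis vector of the
  -- complement, so that basis vector pairs to a divisor of `1`.
  obtain ⟨P', Q', a', h1', h2', hyP⟩ := exists_first_column (fun j : Fin (n + 1) => N⁻¹ j.succ 0)
    (by
      intro h0
      have h3 : ∀ j : Fin (n + 1), N⁻¹ j.succ 0 = 0 := fun j => congrFun h0 j
      simp [h3] at hinv)
  have hcong₁ := hcong.trans (cong_submatrix N (finOneSum _))
  have hcong₂ : Cong (N.submatrix (finOneSum _) (finOneSum _))
    ((fromBlocks 1 0 0 P' : Matrix (Fin 1 ⊕ Fin (n + 1)) (Fin 1 ⊕ Fin (n + 1)) R)ᵀ *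
      N.submatrix (finOneSum _) (finOneSum _) * fromBlocks 1 0 0 P') :=
    ⟨_, fromBlocks 1 0 0 Q', by simp [fromBlocks_multiply, h1'],
      by simp [fromBlocks_multiply, h2'], rfl⟩
  set N₂ := ((fromBlocks 1 0 0 P' : Matrix (Fin 1 ⊕ Fin (n + 1)) (Fin 1 ⊕ Fin (n + 1)) R)ᵀ *
      N.submatrix (finOneSum _) (finOneSum _) * fromBlocks 1 0 0 P') with hN₂
  have hl : N₂ (Sum.inl 0) (Sum.inl 0) = 0 := by
    simp [hN₂, mul_apply, finOneSum_inl, hP]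
  have hlr : a' * N₂ (Sum.inl 0) (Sum.inr 0) = 1 := by
    have h3 : ∀ j : Fin (n + 1), N⁻¹ j.succ 0 = a' * P' j 0 := fun j => congrFun hyP j
    simp only [h3] at hinv
    rw [← hinv]
    have h4 : N₂ (Sum.inl 0) (Sum.inr 0) = ∑ j : Fin (n + 1), N 0 j.succ * P' j 0 := by
      simp [hN₂, mul_apply, finOneSum_inl, finOneSum_inr, one_apply]
    rw [h4, Finset.mul_sum]
    exact Finset.sum_congr rfl fun j _ => by ring
  let e₂ : Fin 2 ⊕ Fin n ≃ Fin 1 ⊕ Fin (n + 1) :=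
    (finSumFinEquiv.trans (finCongr (add_comm 2 n))).trans (finOneSum _).symm
  have e₂0 : e₂ (Sum.inl 0) = Sum.inl 0 := by
    rw [Equiv.trans_apply, Equiv.symm_apply_eq, finOneSum_inl]; ext; simp
  have e₂1 : e₂ (Sum.inl 1) = Sum.inr 0 := by
    rw [Equiv.trans_apply, Equiv.symm_apply_eq, finOneSum_inr]; ext; simp
  have hcong₃ := (hcong₁.trans hcong₂).trans (cong_submatrix N₂ e₂)
  have hsymm := hcong₃.isSymm hM
  set v := N₂ (Sum.inl 0) (Sum.inr 0) with hv
  have hvu : IsUnit v := IsUnit.of_mul_eq_one a' (by rw [mul_comm]; exact hlr)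
  have hblock : (N₂.submatrix e₂ e₂).toBlocks₁₁ =
      !![0, v; v, N₂ (Sum.inr 0) (Sum.inr 0)] := by
    ext1 i j
    fin_cases i <;> fin_cases j
    · simp [toBlocks₁₁, e₂0, hl]
    · simp [toBlocks₁₁, e₂0, e₂1, hv]
    · simpa [toBlocks₁₁, e₂0, e₂1, hv] using hsymm.apply (Sum.inl 0) (Sum.inl 1)
    · simp [toBlocks₁₁, e₂1]
  exact ⟨n, _, v, _, n.lt_succ_self, hvu, hcong₃, hblock⟩

end PID

end Matrix

/-! ### Stable invariance under specialisation of the parameter -/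

namespace MWs

open Matrix

variable {k : Type u} [Field k]

theorem isUnit_det_map {R S : Type*} [CommRing R] [CommRing S] {ι : Type*} [Fintype ι]
    [DecidableEq ι] (φ : R →+* S) {M : Matrix ι ι R} (hM : IsUnit M.det) :
    IsUnit (M.map φ).det := by
  have h := hM.map φ
  rwa [φ.map_det] at h

theorem ofMatrix_map_cong {ι κ : Type} [Fintype ι] [DecidableEq ι] [Fintype κ] [DecidableEq κ]
    {M : Matrix ι ι k[X]} {N : Matrix κ κ k[X]} (h : Cong M N) (hM : M.IsSymm)
    (hu : IsUnit M.det) (φ : k[X] →+* k) : ofMatrix (M.map φ) = ofMatrix (N.map φ) :=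
  ofMatrix_cong (h.map φ) (hM.map φ) (isUnit_det_map φ hu).ne_zero

theorem ofMatrix_map_split {ι κ : Type} [Fintype ι] [DecidableEq ι] [Fintype κ] [DecidableEq κ]
    {N : Matrix (ι ⊕ κ) (ι ⊕ κ) k[X]} (hN : N.IsSymm) (hu : IsUnit N.det)
    (hA : IsUnit N.toBlocks₁₁.det) {φ ψ : k[X] →+* k}
    (h₁ : ofMatrix (N.toBlocks₁₁.map φ) = ofMatrix (N.toBlocks₁₁.map ψ))
    (h₂ : ∀ D : Matrix κ κ k[X], D.IsSymm → IsUnit D.det →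
      ofMatrix (D.map φ) = ofMatrix (D.map ψ)) :
    ofMatrix (N.map φ) = ofMatrix (N.map ψ) := by
  obtain ⟨D, hDs, hDu, key⟩ := exists_cong_fromBlocks hN hu hA
  have hAs : N.toBlocks₁₁.IsSymm := hN.submatrix Sum.inl
  have hφ : ∀ φ : k[X] →+* k, ofMatrix (N.map φ) =
      ofMatrix (N.toBlocks₁₁.map φ) + ofMatrix (D.map φ) := fun φ => by
    rw [ofMatrix_map_cong key hN hu, fromBlocks_map, Matrix.map_zero _ (map_zero φ),
      Matrix.map_zero _ (map_zero φ)]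
    exact ofMatrix_fromBlocks (hAs.map φ) (hDs.map φ) (isUnit_det_map φ hA).ne_zero
      (isUnit_det_map φ hDu).ne_zero
  rw [hφ, hφ, h₁, h₂ D hDs hDu]

/-- The class of a symmetric matrix splits along an invertible diagonal block. -/
theorem exists_ofMatrix_eq_add {ι κ : Type} [Fintype ι] [DecidableEq ι] [Fintype κ]
    [DecidableEq κ] {N : Matrix (ι ⊕ κ) (ι ⊕ κ) k} (hN : N.IsSymm) (hu : IsUnit N.det)
    (hA : IsUnit N.toBlocks₁₁.det) :
    ∃ D : Matrix κ κ k, D.IsSymm ∧ IsUnit D.det ∧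
      ofMatrix N = ofMatrix N.toBlocks₁₁ + ofMatrix D := by
  obtain ⟨D, hDs, hDu, key⟩ := exists_cong_fromBlocks hN hu hA
  refine ⟨D, hDs, hDu, ?_⟩
  rw [ofMatrix_cong key hN hu.ne_zero]
  exact ofMatrix_fromBlocks (hN.submatrix Sum.inl) hDs hA.ne_zero hDu.ne_zero

theorem eval_eq_eval_of_isUnit {p : k[X]} (hp : IsUnit p) (s t : k) : p.eval s = p.eval t := by
  obtain ⟨r, -, rfl⟩ := isUnit_iff.1 hp
  rw [eval_C, eval_C]

/-- Two specialisations of a unimodular symmetric matrix of polynomials in one variable are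
stably isometric. -/
theorem ofMatrix_eval_eq (s t : k) (n : ℕ) : ∀ M : Matrix (Fin n) (Fin n) k[X], M.IsSymm →
    IsUnit M.det → ofMatrix (M.map (evalRingHom s)) = ofMatrix (M.map (evalRingHom t)) := by
  induction n using Nat.strong_induction_on with
  | _ n ih =>
  intro M hM hu
  rcases n with - | n
  · congr 1
    ext i; exact i.elim0
  by_cases hiso : ∀ x, x ≠ 0 → x ⬝ᵥ M *ᵥ x ≠ 0
  · obtain ⟨P, Q, h1, h2, h0, hmin⟩ := exists_minimal_column M hiso
    have hcong : Cong M (Pᵀ * M * P) := ⟨P, Q, h1, h2, rfl⟩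
    set N := Pᵀ * M * P
    -- The determinant is a unit, hence of degree zero. The degree bound makes the minimal value a
    -- non-zero constant.
    have hdeg := (mul_le_natDegree_det (n + 1) (N 0 0).natDegree M hM
      fun x hx => ⟨hiso x hx, hmin x hx⟩).2
    rw [natDegree_eq_zero_of_isUnit hu, Nat.le_zero, mul_eq_zero] at hdeg
    have hunit : IsUnit (N 0 0) :=
      isUnit_iff_degree_eq_zero.2 (by
        rw [degree_eq_natDegree h0, hdeg.resolve_left n.succ_ne_zero]; rfl)
    have hcong' := hcong.trans (cong_submatrix N (finOneSum n))
    rw [ofMatrix_map_cong hcong' hM hu, ofMatrix_map_cong hcong' hM hu]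
    refine ofMatrix_map_split (hcong'.isSymm hM) (hcong'.isUnit_det hu) ?_ ?_
      (fun D => ih n n.lt_succ_self D)
    · rw [det_unique]
      simpa [toBlocks₁₁, finOneSum_inl] using hunit
    · congr 1
      ext i j
      simpa [toBlocks₁₁, finOneSum_inl] using eval_eq_eval_of_isUnit hunit s t
  · push Not at hiso
    obtain ⟨x, hx, hx0⟩ := hiso
    obtain ⟨m, N, v, c, hmn, hvu, hcong, hblock⟩ := exists_cong_of_isotropic hM hu hx hx0
    have hmap : ∀ t : k, ofMatrix ((N.toBlocks₁₁).map (evalRingHom t)) =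
        ofMatrix !![0, v.eval t; v.eval t, 0] := fun t => by
      have h5 := (hvu.map (evalRingHom t)).ne_zero
      rw [coe_evalRingHom] at h5
      rw [← ofMatrix_hyperbolic h5 (c.eval t), hblock]
      congr 1
      ext i j
      fin_cases i <;> fin_cases j <;> simp
    rw [ofMatrix_map_cong hcong hM hu, ofMatrix_map_cong hcong hM hu]
    refine ofMatrix_map_split (hcong.isSymm hM) (hcong.isUnit_det hu) ?_ ?_
      (fun D => ih m (by omega) D)
    · rw [hblock, det_fin_two_of]
      simpa using hvu
    · rw [hmap, hmap, eval_eq_eval_of_isUnit hvu s t]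

end MWs

/-! ## The Bézout form of a sum and its homotopy invariance -/

namespace PointedRat

open Matrix

section Ring

variable {R : Type u} [CommRing R]

/-- The matrix of the coefficients of `δ_{A,B}` of index less than `n`. -/
noncomputable def bezCoeff (n : ℕ) (A B : R[X]) : Matrix (Fin n) (Fin n) R :=
  Matrix.of fun p q => ((bezPoly A B).coeff p).coeff q

theorem bezPoly_map {S : Type*} [CommRing S] (φ : R →+* S) (A B : R[X]) :
    bezPoly (A.map φ) (B.map φ) = (bezPoly A B).map (mapRingHom φ) := by
  refine bezPoly_unique ?_
  have h := congrArg (Polynomial.map (mapRingHom φ)) (bezPoly_spec A B)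
  have hC : ∀ P : R[X], (P.map C).map (mapRingHom φ) = (P.map φ).map C := fun P => by
    rw [Polynomial.map_map, Polynomial.map_map]
    congr 1
    ext x; simp
  simpa [cross, hC] using h

theorem bezCoeff_map {S : Type*} [CommRing S] (φ : R →+* S) (n : ℕ) (A B : R[X]) :
    bezCoeff n (A.map φ) (B.map φ) = (bezCoeff n A B).map φ := by
  ext p q
  simp [bezCoeff, bezPoly_map]

theorem bezCoeff_isSymm (n : ℕ) (A B : R[X]) : (bezCoeff n A B).IsSymm := by
  ext1 p q
  exact coeff_bezPoly_comm _ _ _ _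

theorem coeff_bezPoly_lin_add [Nontrivial R] (u : Rˣ) (g : PointedRat R) (p q : ℕ) :
    ((bezPoly (lin u + g).num (lin u + g).den).coeff p).coeff q =
      u * g.num.coeff p * g.num.coeff q + ((bezPoly g.num g.den).coeff p).coeff q := by
  have h : bezPoly (lin u + g).num (lin u + g).den =
      C (C (u : R)) * C g.num * g.num.map C + bezPoly g.num g.den := by
    refine bezPoly_unique ?_
    rw [mul_add, bezPoly_spec, num_lin_add, den_lin_add]
    have hu : C (C (u : R)) * C (C (↑u⁻¹ : R)) = (1 : R[X][X]) := by
      rw [← C_mul, ← C_mul, Units.mul_inv, C_1, C_1]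
    simp only [cross, Polynomial.map_sub, Polynomial.map_mul, Polynomial.map_X, Polynomial.map_C,
      C_sub, C_mul]
    linear_combination (g.den.map C * C g.num - C g.den * g.num.map C) * hu
  rw [h, coeff_add, coeff_add, ← C_mul, coeff_C_mul, coeff_map, coeff_mul_C, coeff_C_mul]
  ring

/-- Modulo `A`, the numerator `X A - u⁻¹ B` reduces to `-u⁻¹ B`. The scalars contribute `uⁿ⁺¹
(-u⁻¹)ⁿ = (-1)ⁿ u`, where `n` is the degree of `g`. -/
theorem res_lin_add [Nontrivial R] (u : Rˣ) (g : PointedRat R) :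
    (lin u + g).res = (-1) ^ g.deg * u * g.res := by
  have hA := (lin u + g).monic
  have hdeg : (lin u + g).deg = g.deg + 1 := by rw [deg_add, deg_lin, add_comm]
  have hdeg' : (lin u + g).num.natDegree = g.deg + 1 := hdeg
  have hg : g.num.natDegree = g.deg := rfl
  have hden : g.den.natDegree ≤ g.deg := natDegree_le_natDegree g.degree_den_lt.le
  have h1 : (lin u + g).num.coeff (g.deg + 1) = 1 := hdeg' ▸ hA.coeff_natDegree
  have h2 : (lin u + g).num = C (-(↑u⁻¹ : R)) * g.den + g.num * X := by
    rw [num_lin_add, C_neg]; ring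
  have h3 : g.num.coeff g.deg = 1 := g.monic.coeff_natDegree
  rw [res, hdeg, den_lin_add, resultant_C_mul_right, resultant_add_right_deg _ _ _ _ 1 hg.le, h1,
    one_pow, one_mul, resultant_comm, h2, resultant_add_mul_right _ _ _ _ _
      (by rw [natDegree_X, add_comm]) hg.le, resultant_C_mul_right,
    resultant_add_right_deg _ _ _ _ 1 hden, h3, one_pow, one_mul]
  -- Exchanging the two arguments, in sizes `n + 1` and `n`, introduces no sign.
  have h4 : Even ((g.deg + 1) * g.deg) := by rw [mul_comm]; exact Nat.even_mul_succ_self _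
  rw [h4.neg_one_pow, one_mul, neg_pow, pow_succ]
  have h5 : (u : R) ^ g.deg * (↑u⁻¹ : R) ^ g.deg = 1 := by
    rw [← mul_pow, Units.mul_inv, one_pow]
  change _ * ((_ * _) * g.res) = _
  linear_combination (-1) ^ g.deg * (u : R) * g.res * h5

end Ring

/-! ### Homotopy invariance and splitting of the Bézout form -/

section Field

variable {k : Type u} [Field k]

/-- A separate size `n` lets functions of equal degree be compared through matrices of one type. -/
theorem mk_bezForm {f : PointedRat k} {n : ℕ} (h : f.deg = n) :
    MWs.mk f.bezForm = MWs.ofMatrix (bezCoeff n f.num f.den) := by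
  subst h
  exact (MWs.ofMatrix_eq f.bezMatrix_isSymm f.det_bezMatrix_ne_zero).symm

theorem coe_bezDet {f : PointedRat k} {n : ℕ} (h : f.deg = n) :
    (f.bezDet : k) = (bezCoeff n f.num f.den).det := by
  subst h
  rfl

/-- A root of the determinant in the algebraic closure would give, by specialisation, a pointed
rational function over a field with degenerate Bézout form. -/
theorem isUnit_det_bezMatrix (F : PointedRat k[X]) : IsUnit (bezCoeff F.deg F.num F.den).det := by
  rw [isUnit_iff_degree_eq_zero]
  by_contra hdeg
  obtain ⟨t, ht⟩ := IsAlgClosed.exists_aeval_eq_zero (AlgebraicClosure k) _ hdeg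
  have h1 := (F.map (aeval t : k[X] →ₐ[k] AlgebraicClosure k).toRingHom).bezDet.ne_zero
  rw [coe_bezDet (deg_map _ F)] at h1
  change (bezCoeff F.deg (F.num.map _) (F.den.map _)).det ≠ 0 at h1
  rw [bezCoeff_map] at h1
  refine h1 ?_
  rw [← ht]
  exact ((aeval t : k[X] →ₐ[k] AlgebraicClosure k).toRingHom.map_det _).symm

theorem Homotopy.mk_bezForm_eq {f g : PointedRat k} (h : Homotopy f g) :
    MWs.mk f.bezForm = MWs.mk g.bezForm := by
  obtain ⟨F, rfl, rfl⟩ := h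
  rw [mk_bezForm (deg_map _ F), mk_bezForm (deg_map _ F)]
  change MWs.ofMatrix (bezCoeff F.deg (F.num.map _) (F.den.map _)) =
    MWs.ofMatrix (bezCoeff F.deg (F.num.map _) (F.den.map _))
  rw [bezCoeff_map, bezCoeff_map]
  exact MWs.ofMatrix_eval_eq 0 1 _ _ (bezCoeff_isSymm _ _ _) (isUnit_det_bezMatrix F)

theorem Homotopy.bezDet_eq {f g : PointedRat k} (h : Homotopy f g) : f.bezDet = g.bezDet := by
  obtain ⟨F, rfl, rfl⟩ := h
  ext
  rw [coe_bezDet (deg_map _ F), coe_bezDet (deg_map _ F)]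
  change (bezCoeff F.deg (F.num.map _) (F.den.map _)).det =
    (bezCoeff F.deg (F.num.map _) (F.den.map _)).det
  rw [bezCoeff_map, bezCoeff_map]
  have h1 := MWs.eval_eq_eval_of_isUnit (isUnit_det_bezMatrix F) 0 1
  have h2 : ∀ t : k, ((bezCoeff F.deg F.num F.den).map (evalRingHom t)).det =
      (bezCoeff F.deg F.num F.den).det.eval t := fun t => ((evalRingHom t).map_det _).symm
  rw [h2, h2, h1]

theorem res_map {R S : Type u} [CommRing R] [CommRing S] [Nontrivial S] (φ : R →+* S)
    (F : PointedRat R) : (F.map φ).res = φ F.res := by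
  rw [res, deg_map]
  exact resultant_map_map _ _ _ _ φ

theorem Homotopy.res_eq {f g : PointedRat k} (h : Homotopy f g) : f.res = g.res := by
  obtain ⟨F, rfl, rfl⟩ := h
  rw [res_map, res_map]
  exact MWs.eval_eq_eval_of_isUnit F.isUnit_resultant 0 1

/-- The Gram matrix of the Bézout form of `X / u ⊕ g`, up to a unipotent change of basis. -/
theorem exists_bezCoeff_lin_add (u : kˣ) (g : PointedRat k) :
    ∃ (e : Fin 1 ⊕ Fin g.deg ≃ Fin (g.deg + 1)) (a : Matrix (Fin 1) (Fin g.deg) k),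
      (bezCoeff (g.deg + 1) (lin u + g).num (lin u + g).den).submatrix e e =
        (fromBlocks 1 a 0 1)ᵀ * fromBlocks (of fun _ _ : Fin 1 => (u : k)) 0 0 g.bezMatrix *
          fromBlocks 1 a 0 1 := by
  have h0 : ∀ q, ((bezPoly g.num g.den).coeff g.deg).coeff q = 0 := fun q => by
    rw [coeff_bezPoly_comm, coeff_coeff_bezPoly g q _ le_rfl]
  have h0' : ∀ p, ((bezPoly g.num g.den).coeff p).coeff g.deg = 0 := fun p =>
    coeff_coeff_bezPoly g p _ le_rfl
  have h1 : g.num.coeff g.deg = 1 := g.monic.coeff_natDegree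
  -- The last index is moved to the front. It carries the leading coefficient `1` of the numerator
  -- of `g`, whose lower coefficients form the row `a`.
  refine ⟨(Equiv.sumComm _ _).trans finSumFinEquiv, of fun _ q => g.num.coeff q, ?_⟩
  ext i j
  rcases i with i | i <;> rcases j with j | j <;>
    simp [fromBlocks_transpose, fromBlocks_multiply, mul_apply, bezCoeff, coeff_bezPoly_lin_add,
      h0, h0', h1, bezMatrix, one_apply, mul_comm, Fin.eq_zero]

theorem mk_bezForm_lin_add (u : kˣ) (g : PointedRat k) :
    MWs.mk (lin u + g).bezForm = MWs.unary u + MWs.mk g.bezForm := by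
  obtain ⟨e, a, h⟩ := exists_bezCoeff_lin_add u g
  have hu : (of fun _ _ : Fin 1 => (u : k)).IsSymm := rfl
  have hd : (of fun _ _ : Fin 1 => (u : k)).det ≠ 0 := by simp
  have hdeg : (lin u + g).deg = g.deg + 1 := by rw [deg_add, deg_lin, add_comm]
  have hdet : (bezCoeff (g.deg + 1) (lin u + g).num (lin u + g).den).det ≠ 0 := by
    rw [← coe_bezDet hdeg]; exact Units.ne_zero _
  have h1 := MWs.ofMatrix_cong (cong_submatrix _ e) (bezCoeff_isSymm _ _ _) hdet
  have h2 : Cong (fromBlocks (of fun _ _ : Fin 1 => (u : k)) 0 0 g.bezMatrix)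
      ((bezCoeff (g.deg + 1) (lin u + g).num (lin u + g).den).submatrix e e) :=
    ⟨fromBlocks 1 a 0 1, fromBlocks 1 (-a) 0 1, by simp [fromBlocks_multiply],
      by simp [fromBlocks_multiply], h⟩
  rw [mk_bezForm hdeg, h1, ← MWs.ofMatrix_cong h2
    (MWs.isSymm_fromBlocks hu g.bezMatrix_isSymm)
    (by rw [det_fromBlocks_zero₂₁]; exact mul_ne_zero hd g.det_bezMatrix_ne_zero),
    MWs.ofMatrix_fromBlocks hu g.bezMatrix_isSymm hd g.det_bezMatrix_ne_zero, MWs.ofMatrix_unary]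
  rw [mk_bezForm (f := g) rfl]
  rfl

theorem bezDet_lin_add (u : kˣ) (g : PointedRat k) : (lin u + g).bezDet = u * g.bezDet := by
  obtain ⟨e, a, h⟩ := exists_bezCoeff_lin_add u g
  have hdeg : (lin u + g).deg = g.deg + 1 := by rw [deg_add, deg_lin, add_comm]
  ext
  rw [coe_bezDet hdeg, ← det_submatrix_equiv_self e, h, det_mul, det_mul, det_transpose,
    det_fromBlocks_zero₂₁, det_fromBlocks_zero₂₁]
  simp [bezDet]

theorem bezDet_zero : (0 : PointedRat k).bezDet = 1 := by
  ext
  rw [coe_bezDet (f := (0 : PointedRat k)) (n := 0) natDegree_one]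
  simp

theorem mk_bezForm_zero : MWs.mk (0 : PointedRat k).bezForm = 0 := by
  rw [mk_bezForm (f := (0 : PointedRat k)) (n := 0) natDegree_one,
    MWs.ofMatrix_eq (bezCoeff_isSymm _ _ _) (by simp),
    ← MWs.mk_zero]
  have key : ∀ x y : Fin 0 → k, (0 : k) =
      toBilin' (bezCoeff 0 (0 : PointedRat k).num (0 : PointedRat k).den) x y := fun x y => by
    rw [toBilin'_apply']
    simp
  let e : (Fin 0 → k) ≃ₗ[k] PUnit.{u + 1} := 0
  exact MWs.mk_eq ⟨e, key⟩

end Field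

end PointedRat

/-! ## Diagonal forms -/

/-- The orthogonal sum of forms of rank one. -/
noncomputable def NDForm.diag {k : Type u} [Field k] : List kˣ → NDForm k
  | [] => 0
  | u :: l => NDForm.unary u + NDForm.diag l

namespace MWs

open Matrix

variable {k : Type u} [Field k]

/-- The class of an orthogonal sum of forms of rank one. -/
noncomputable def diag (l : List kˣ) : MWs k := mk (NDForm.diag l)

theorem diag_nil : diag ([] : List kˣ) = 0 := rfl

theorem diag_cons (u : kˣ) (l : List kˣ) : diag (u :: l) = unary u + diag l := rfl

theorem unary_mul_sq (u s : kˣ) : unary (u * s ^ 2) = unary u := by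
  have key : ∀ x y : k, (NDForm.unary u).form (s * x : k) (s * y : k) =
      (NDForm.unary (u * s ^ 2)).form x y := fun x y => by
    rw [NDForm.unary_apply, NDForm.unary_apply]
    push_cast
    ring
  exact mk_eq ⟨LinearEquiv.smulOfUnit s, key⟩

/-- The stable class ignores `c`, which may be taken to be `1`; then `e₂` and `e₁ - v e₂` are
orthogonal with values `1` and `-v²`. -/
theorem ofMatrix_hyperbolic_eq_diag (v : kˣ) (c : k) :
    ofMatrix !![0, (v : k); v, c] = diag [1, -v ^ 2] := by
  have h1 : Cong !![0, (v : k); v, 1] (fromBlocks (of fun _ _ : Fin 1 => ((1 : kˣ) : k)) 0 0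
      (of fun _ _ : Fin 1 => ((-v ^ 2 : kˣ) : k))) := by
    refine ⟨of fun i j => Sum.elim (fun _ => ![0, 1] i) (fun _ => ![1, -(v : k)] i) j,
      of fun i j => Sum.elim (fun _ => ![(v : k), 1] j) (fun _ => ![1, 0] j) i, ?_, ?_, ?_⟩
    · ext i j
      fin_cases i <;> fin_cases j <;> simp [mul_apply]
    · ext i j
      rcases i with i | i <;> rcases j with j | j <;> fin_cases i <;> fin_cases j <;>
        simp [mul_apply, one_apply]
    · ext i j
      rcases i with i | i <;> rcases j with j | j <;> fin_cases i <;> fin_cases j <;>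
        (simp [mul_apply]; try ring)
  rw [ofMatrix_hyperbolic v.ne_zero, ← ofMatrix_hyperbolic v.ne_zero 1,
    ofMatrix_cong h1 (isSymm_hyperbolic _ _) (by simp),
    ofMatrix_fromBlocks (by ext; rfl) (by ext; rfl) (by simp) (by simp), ofMatrix_unary,
    ofMatrix_unary, diag_cons, diag_cons, diag_nil, add_zero]

theorem add_diag_of_eq_diag {x : MWs k} {l l' : List kˣ} (hx : x = diag l) :
    x + diag l' = diag (l ++ l') := by
  rw [hx]
  clear hx
  induction l with
  | nil => rw [diag_nil, zero_add, List.nil_append]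
  | cons u l ih => rw [diag_cons, List.cons_append, diag_cons, add_assoc, ih]

theorem exists_ofMatrix_eq_diag (n : ℕ) : ∀ M : Matrix (Fin n) (Fin n) k, M.IsSymm →
    IsUnit M.det → ∃ l : List kˣ, ofMatrix M = diag l := by
  induction n using Nat.strong_induction_on with
  | _ n ih =>
  intro M hM hu
  rcases n with - | n
  · refine ⟨[], ?_⟩
    rw [ofMatrix_eq hM hu.ne_zero, diag_nil, ← mk_zero]
    have key : ∀ x y : Fin 0 → k, (0 : k) = toBilin' M x y := fun x y => by
      rw [toBilin'_apply']
      simp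
    let e : (Fin 0 → k) ≃ₗ[k] PUnit.{u + 1} := 0
    exact mk_eq ⟨e, key⟩
  by_cases hx : ∃ x, x ⬝ᵥ M *ᵥ x ≠ 0
  · obtain ⟨x, hx⟩ := hx
    have hx0 : x ≠ 0 := by
      rintro rfl
      simp at hx
    obtain ⟨N, a, -, hcong, hN⟩ := exists_cong_of_ne_zero M hx0
    rw [hN] at hx
    have hcong' := hcong.trans (cong_submatrix N (finOneSum n))
    have hN0 : (N.submatrix (finOneSum n) (finOneSum n)).toBlocks₁₁ =
        of fun _ _ : Fin 1 => ((Units.mk0 _ (right_ne_zero_of_mul hx) : kˣ) : k) := by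
      ext i j
      simp [toBlocks₁₁, finOneSum_inl]
    obtain ⟨D, hD, hDu, h⟩ := exists_ofMatrix_eq_add (hcong'.isSymm hM) (hcong'.isUnit_det hu)
      (by rw [hN0]; simp [right_ne_zero_of_mul hx])
    obtain ⟨l, hl⟩ := ih n n.lt_succ_self D hD hDu
    exact ⟨_, by rw [ofMatrix_cong hcong' hM hu.ne_zero, h, hN0, ofMatrix_unary, hl, ← diag_cons]⟩
  · push Not at hx
    obtain ⟨m, N, v, c, hmn, hv, hcong, hblock⟩ :=
      -- All values vanish here, so any non-zero vector serves.
      exists_cong_of_isotropic hM hu (one_ne_zero (α := Fin (n + 1) → k)) (hx _)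
    obtain ⟨D, hD, hDu, h⟩ := exists_ofMatrix_eq_add (hcong.isSymm hM) (hcong.isUnit_det hu)
      (by rw [hblock]; simpa using hv.ne_zero)
    obtain ⟨v, rfl⟩ := hv
    obtain ⟨l, hl⟩ := ih m (by omega) D hD hDu
    exact ⟨_, by rw [ofMatrix_cong hcong hM hu.ne_zero, h, hblock, hl,
      add_diag_of_eq_diag (ofMatrix_hyperbolic_eq_diag v c)]⟩

/-- Every form is stably isometric to a diagonal one. -/
theorem exists_eq_diag (x : MWs k) : ∃ l : List kˣ, x = diag l := by
  induction x using AddCon.induction_on with | _ x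
  obtain ⟨b⟩ := x
  change ∃ l, mk b = diag l
  let e := Module.finBasis k b.V
  have hs : (LinearMap.BilinForm.toMatrix e b.form).IsSymm := by
    ext i j
    simp [LinearMap.BilinForm.toMatrix_apply, b.symm.eq]
  have hd := (LinearMap.BilinForm.nondegenerate_iff_det_ne_zero e).1 b.nondegenerate
  obtain ⟨l, hl⟩ := exists_ofMatrix_eq_diag _ _ hs hd.isUnit
  refine ⟨l, ?_⟩
  rw [← hl, ofMatrix_eq hs hd]
  have key : ∀ x y : b.V, toBilin' (LinearMap.BilinForm.toMatrix e b.form)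
      (e.equivFun x) (e.equivFun y) = b.form x y := fun x y => by
    rw [toBilin'_apply']
    have := LinearMap.BilinForm.dotProduct_toMatrix_mulVec e b.form (e.equivFun x) (e.equivFun y)
    simpa using this
  exact mk_eq ⟨e.equivFun, key⟩

/-- If `b ⊕ d ≃ c ⊕ d`, then `b ⊕ (-c)` has a totally isotropic subspace of dimension at least
the rank of `b`. -/
theorem exists_submodule_of_mk_eq {b c : NDForm k} (h : mk b = mk c) :
    ∃ L : Submodule k (b.V × c.V), b.rank ≤ Module.finrank k L ∧
      ∀ z ∈ L, b.form z.1 z.1 = c.form z.2 z.2 := by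
  obtain ⟨d, E, hE⟩ := mk_eq_iff.1 h
  change (b.V × d.V) ≃ₗ[k] (c.V × d.V) at E
  have hE' : ∀ x y : b.V × d.V, c.form (E x).1 (E y).1 + d.form (E x).2 (E y).2 =
    b.form x.1 y.1 + d.form x.2 y.2 := hE
  -- The kernel of `Φ` consists of the `(x, w)` with `E (x, w) = (y, w)` for some `y`, and `π` sends
  -- such a pair to `(x, y)`. The subspace is the reduction of the graph of `E` along the diagonal
  -- of `d`.
  let Φ : b.V × d.V →ₗ[k] d.V :=
    (LinearMap.snd k c.V d.V).comp E.toLinearMap - LinearMap.snd k b.V d.V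
  let π : b.V × d.V →ₗ[k] b.V × c.V :=
    (LinearMap.fst k b.V d.V).prod ((LinearMap.fst k c.V d.V).comp E.toLinearMap)
  let F : Submodule k d.V := LinearMap.ker
    (E.toLinearMap.comp (LinearMap.inr k b.V d.V) - LinearMap.inr k c.V d.V)
  have hF : ∀ z ∈ F, E (0, z) = (0, z) := fun z hz => by
    simpa [F, sub_eq_zero] using hz
  have hΦ : ∀ x, Φ x = (E x).2 - x.2 := fun _ => rfl
  have hπ : ∀ x, π x = (x.1, (E x).1) := fun _ => rfl
  -- Vectors fixed by `E` inside `d` are orthogonal to every `Φ x`, as `E` is an isometry. So `dim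
  -- ker Φ ≥ dim b + dim F`, and the loss under `π` is at most `dim F`.
  have h1 : LinearMap.range Φ ≤ d.form.orthogonal F := by
    rintro _ ⟨x, rfl⟩ z hz
    have h2 := hE' (0, z) x
    rw [hF z hz] at h2
    simp only [map_zero, LinearMap.zero_apply, zero_add] at h2
    rw [hΦ, map_sub, h2, sub_self]
  have h2 := LinearMap.BilinForm.finrank_orthogonal d.nondegenerate F
  have h3 := LinearMap.finrank_range_add_finrank_ker Φ
  have h4 := LinearMap.finrank_range_add_finrank_ker (π.domRestrict (LinearMap.ker Φ))
  have h5 : Module.finrank k (LinearMap.ker (π.domRestrict (LinearMap.ker Φ))) ≤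
      Module.finrank k F := by
    have h0 : ∀ x : LinearMap.ker (π.domRestrict (LinearMap.ker Φ)),
        x.1.1.1 = 0 ∧ E x.1.1 = (0, x.1.1.2) := fun x => by
      have h6 : π x.1.1 = 0 := x.2
      have h7 : Φ x.1.1 = 0 := x.1.2
      rw [hπ] at h6
      rw [hΦ, sub_eq_zero] at h7
      exact ⟨congrArg Prod.fst h6, Prod.ext (congrArg Prod.snd h6) h7⟩
    refine LinearMap.finrank_le_finrank_of_injective
      (f := ((LinearMap.snd k b.V d.V).comp ((LinearMap.ker Φ).subtype.comp
        (LinearMap.ker (π.domRestrict (LinearMap.ker Φ))).subtype)).codRestrict F ?_) ?_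
    · intro x
      have h6 := (h0 x).2
      rw [show x.1.1 = (0, x.1.1.2) from Prod.ext (h0 x).1 rfl] at h6
      rw [LinearMap.mem_ker, LinearMap.sub_apply, sub_eq_zero]
      exact h6
    · intro x y hxy
      refine Subtype.ext (Subtype.ext (Prod.ext ?_ (congrArg Subtype.val hxy)))
      rw [(h0 x).1, (h0 y).1]
  rw [LinearMap.range_domRestrict] at h4
  have h6 := Submodule.finrank_mono h1
  have h7 := Module.finrank_prod (R := k) (M := b.V) (M' := d.V)
  have h8 := Submodule.finrank_le F
  refine ⟨(LinearMap.ker Φ).map π, ?_, ?_⟩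
  · unfold NDForm.rank
    omega
  · rintro _ ⟨x, hx, rfl⟩
    have h9 := hE' x x
    have hx' : (E x).2 = x.2 := sub_eq_zero.1 hx
    rw [hx'] at h9
    exact (add_right_cancel h9).symm

end MWs

/-! ## The classification of naive homotopy classes -/

namespace NaiveClass

open PointedRat

variable {k : Type u} [Field k]

theorem mk_lin_add (u : kˣ) (g : PointedRat k) : mk (PointedRat.lin u + g) = lin u + mk g := rfl

theorem induction_lin {p : NaiveClass k → Prop} (x : NaiveClass k) (zero : p 0)
    (add : ∀ u x, p x → p (lin u + x)) : p x := by
  obtain ⟨l, rfl⟩ := exists_eq_linSum x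
  induction l with
  | nil => exact zero
  | cons u l ih => rw [linSum_cons]; exact add u _ ih

/-- The stable isometry class of the Bézout form. -/
noncomputable def bez : NaiveClass k →+ MWs k :=
  have hlin : ∀ (u : kˣ) (y : NaiveClass k),
      Quot.lift (fun f => MWs.mk f.bezForm) (fun _ _ h => h.mk_bezForm_eq) (lin u + y) =
      MWs.unary u + Quot.lift (fun f => MWs.mk f.bezForm) (fun _ _ h => h.mk_bezForm_eq) y := by
    rintro u ⟨g⟩
    exact mk_bezForm_lin_add u g
  { toFun := Quot.lift (fun f => MWs.mk f.bezForm) (fun _ _ h => h.mk_bezForm_eq)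
    map_zero' := mk_bezForm_zero
    -- Additivity in the first variable is only known for the `X / u`; these generate the monoid.
    map_add' := fun x y => by
      induction x using induction_lin with
      | zero => rw [zero_add]; exact (zero_add _).symm.trans (congrArg (· + _) mk_bezForm_zero.symm)
      | add u x ih => rw [add_assoc, hlin, ih, hlin, add_assoc] }

/-- The determinant of the Bézout form. -/
noncomputable def bezDet : NaiveClass k →+ Additive kˣ :=
  have hlin : ∀ (u : kˣ) (y : NaiveClass k),
      Quot.lift (fun f => Additive.ofMul f.bezDet) (fun _ _ h => congrArg _ h.bezDet_eq)
        (lin u + y) = Additive.ofMul u +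
      Quot.lift (fun f => Additive.ofMul f.bezDet) (fun _ _ h => congrArg _ h.bezDet_eq) y := by
    rintro u ⟨g⟩
    exact congrArg Additive.ofMul (bezDet_lin_add u g)
  { toFun := Quot.lift (fun f => Additive.ofMul f.bezDet) (fun _ _ h => congrArg _ h.bezDet_eq)
    map_zero' := congrArg Additive.ofMul bezDet_zero
    map_add' := fun x y => by
      induction x using induction_lin with
      | zero =>
        rw [zero_add]
        exact (zero_add _).symm.trans (congrArg (Additive.ofMul · + _) bezDet_zero.symm)
      | add u x ih => rw [add_assoc, hlin, ih, hlin, add_assoc] }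

theorem bez_mk (f : PointedRat k) : bez (mk f) = MWs.mk f.bezForm := rfl

theorem bezDet_mk (f : PointedRat k) : bezDet (mk f) = Additive.ofMul f.bezDet := rfl

theorem degree_lin (u : kˣ) : degree (lin u) = 1 := deg_lin u

theorem bez_lin (u : kˣ) : bez (lin u) = MWs.unary u := by
  rw [← add_zero (lin u), ← mk_zero, ← mk_lin_add, bez_mk, mk_bezForm_lin_add, mk_bezForm_zero,
    add_zero]

theorem bezDet_lin (u : kˣ) : bezDet (lin u) = Additive.ofMul u := by
  rw [← add_zero (lin u), ← mk_zero, ← mk_lin_add, bezDet_mk, bezDet_lin_add, bezDet_zero, mul_one]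

theorem bez_linSum (l : List kˣ) : bez (linSum l) = MWs.diag l := by
  induction l with
  | nil => exact map_zero bez
  | cons u l ih => rw [linSum_cons, map_add, ih, bez_lin]; rfl

theorem bezDet_linSum (l : List kˣ) : bezDet (linSum l) = Additive.ofMul l.prod := by
  induction l with
  | nil => exact map_zero bezDet
  | cons u l ih => rw [linSum_cons, map_add, ih, bezDet_lin, List.prod_cons, ofMul_mul]

theorem degree_linSum (l : List kˣ) : degree (linSum l) = l.length := by
  induction l with
  | nil => exact map_zero degree
  | cons u l ih => rw [linSum_cons, map_add, ih, degree_lin, List.length_cons, add_comm]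

theorem rank_bez (x : NaiveClass k) : MWs.rank (bez x) = degree x := by
  obtain ⟨f⟩ := x
  change MWs.rank (MWs.mk f.bezForm) = f.deg
  rw [MWs.rank_mk]
  exact Module.finrank_fin_fun k

theorem disc_bez (x : NaiveClass k) :
    MWs.disc (bez x) = Additive.ofMul (QuotientGroup.mk (bezDet x).toMul) := by
  obtain ⟨f⟩ := x
  change MWs.disc (MWs.mk f.bezForm) = Additive.ofMul (QuotientGroup.mk f.bezDet)
  rw [MWs.disc_mk, NDForm.disc_eq' f.bezForm (Pi.basisFun k (Fin f.deg))]
  congr 2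
  ext
  change (LinearMap.BilinForm.toMatrix (Pi.basisFun k (Fin f.deg))
    (Matrix.toBilin' f.bezMatrix)).det = f.bezMatrix.det
  rw [LinearMap.BilinForm.toMatrix_basisFun, LinearMap.BilinForm.toMatrix'_toBilin']

theorem eq_zero_of_degree {x : NaiveClass k} (h : degree x = 0) : x = 0 := by
  obtain ⟨f⟩ := x
  exact congrArg mk (eq_zero_of_deg_eq_zero h)

/-- The sign formula for the determinant of the Bézout matrix. -/
theorem coe_bezDet_eq (n : ℕ) : ∀ f : PointedRat k, f.deg = n →
    (f.bezDet : k) = (-1) ^ (n * (n - 1) / 2) * f.res := by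
  have hres : ∀ f g : PointedRat k, mk f = mk g → f.res = g.res := fun f g h =>
    congrArg (Quot.lift PointedRat.res fun _ _ h => h.res_eq) h
  induction n with
  | zero =>
    intro f hf
    rw [eq_zero_of_deg_eq_zero hf, bezDet_zero]
    change (1 : k) = _ * resultant 1 0 (1 : k[X]).natDegree (1 : k[X]).natDegree
    simp
  | succ n ih =>
    intro f hf
    obtain ⟨u, g, hg, h⟩ := exists_mk_eq_lin_add f hf
    have h1 : f.bezDet = (PointedRat.lin u + g).bezDet :=
      Additive.ofMul.injective (congrArg bezDet h)
    rw [h1, hres f (PointedRat.lin u + g) h, bezDet_lin_add, Units.val_mul, ih g hg, res_lin_add,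
      hg]
    have h2 : (n + 1) * (n + 1 - 1) / 2 = n * (n - 1) / 2 + n :=
      Nat.triangle_succ n
    have h3 : ((-1 : k) ^ n) * (-1) ^ n = 1 := by rw [← mul_pow]; simp
    rw [h2, pow_add]
    linear_combination -(-1) ^ (n * (n - 1) / 2) * (u : k) * g.res * h3

/-! ### Values of diagonal forms -/

theorem diag_apply (u : kˣ) (l : List kˣ) (a : k) (y : (NDForm.diag l).V) :
    (NDForm.diag (u :: l)).form (a, y) (a, y) =
      u * a ^ 2 + (NDForm.diag l).form y y := by
  rw [pow_two]; rfl

theorem diag_singleton_apply (v : kˣ) (z : (NDForm.diag [v]).V) :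
    ∃ b : k, (NDForm.diag [v]).form z z = v * b ^ 2 := by
  obtain ⟨b, w⟩ := z
  exact ⟨b, (diag_apply v [] b w).trans (add_zero _)⟩

/-- A non-zero value of a diagonal form of rank at least two splits off. -/
theorem exists_linSum_eq_of_value (l : List kˣ) (h : 2 ≤ l.length) (c : kˣ)
    (x : (NDForm.diag l).V) (hx : (NDForm.diag l).form x x = c) :
    ∃ y : NaiveClass k, linSum l = lin c + y := by
  induction l generalizing c with
  | nil => simp at h
  | cons u l ih =>
    obtain ⟨(a : k), z⟩ := x
    replace hx := (diag_apply u l a z).symm.trans hx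
    rcases l with - | ⟨v, l⟩
    · simp at h
    rcases l with - | ⟨w, l⟩
    · obtain ⟨b, hb⟩ := diag_singleton_apply v z
      rw [hb] at hx
      refine ⟨lin (u * v / c), ?_⟩
      rw [linSum_cons, linSum_cons, linSum_nil, add_zero]
      exact lin_add_lin_of_repr u v c hx.symm
    -- If the tail contributes nothing, `c = u a²`, and the next entry `v` enters with coefficient
    -- zero: the relation needs a second summand to absorb the square.
    by_cases hz : (NDForm.diag (v :: w :: l)).form z z = 0
    · rw [hz, add_zero] at hx
      refine ⟨lin (u * v / c) + linSum (w :: l), ?_⟩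
      rw [linSum_cons, linSum_cons v, ← add_assoc, ← add_assoc,
        lin_add_lin_of_repr u v c (a := a) (b := 0) (by rw [← hx]; simp)]
    · obtain ⟨y, hy⟩ := ih (by simp) (Units.mk0 _ hz) z rfl
      refine ⟨lin (u * Units.mk0 _ hz / c) + y, ?_⟩
      rw [linSum_cons, hy, ← add_assoc, ← add_assoc,
        lin_add_lin_of_repr u (Units.mk0 _ hz) c (a := a) (b := 1) (by rw [← hx]; simp)]

/-- An isotropic diagonal form splits off the form of rank one with value `1`. -/
theorem exists_linSum_eq_of_isotropic (l : List kˣ) (x : (NDForm.diag l).V) (hx0 : x ≠ 0)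
    (hx : (NDForm.diag l).form x x = 0) :
    ∃ y : NaiveClass k, linSum l = lin 1 + y := by
  induction l with
  | nil => exact (hx0 rfl).elim
  | cons u l ih =>
    obtain ⟨(a : k), z⟩ := x
    replace hx := (diag_apply u l a z).symm.trans hx
    rcases eq_or_ne a 0 with rfl | ha
    · obtain ⟨y, hy⟩ := ih z (by rintro rfl; exact hx0 rfl) (by simpa using hx)
      exact ⟨lin u + y, by rw [linSum_cons, hy, ← add_assoc, lin_add_comm, add_assoc]⟩
    -- Since `a ≠ 0`, the tail takes the non-zero value `-u a²`, which can be split off to reach an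
    -- isotropic binary form.
    · have hz : (NDForm.diag l).form z z ≠ 0 := fun h => by
        rw [h, add_zero] at hx
        simp [ha] at hx
      rcases l with - | ⟨v, l⟩
      · exact (hz rfl).elim
      rcases l with - | ⟨w, l⟩
      · obtain ⟨b, hb⟩ := diag_singleton_apply v z
        rw [hb] at hx hz
        refine ⟨lin (u * v), ?_⟩
        rw [linSum_cons, linSum_cons, linSum_nil, add_zero]
        exact lin_add_lin_of_isotropic u v (by rintro rfl; simp at hz) hx
      · obtain ⟨y, hy⟩ := exists_linSum_eq_of_value (v :: w :: l) (by simp) (Units.mk0 _ hz) z rfl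
        refine ⟨lin (u * Units.mk0 _ hz) + y, ?_⟩
        rw [linSum_cons, hy, ← add_assoc, ← add_assoc,
          lin_add_lin_of_isotropic u (Units.mk0 _ hz) (a := a) one_ne_zero (by simpa using hx)]

theorem rank_diag (l : List kˣ) : (NDForm.diag l).rank = l.length := by
  rw [← degree_linSum l, ← rank_bez, bez_linSum]
  rfl

/-- Two diagonal forms of the same rank at least two which are stably isometric have a common
value split off. -/
theorem exists_common_value (l l' : List kˣ) (h : 2 ≤ l.length) (h' : 2 ≤ l'.length)
    (hl : MWs.diag l = MWs.diag l') :
    ∃ (c : kˣ) (y y' : NaiveClass k), linSum l = lin c + y ∧ linSum l' = lin c + y' := by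
  obtain ⟨L, hL, hLq⟩ := MWs.exists_submodule_of_mk_eq hl
  have hlen : l.length = l'.length := by
    rw [← degree_linSum, ← degree_linSum, ← rank_bez, ← rank_bez, bez_linSum, bez_linSum, hl]
  have hnz : ∀ l : List kˣ, 2 ≤ l.length → ∃ x, (NDForm.diag l).form x x ≠ 0 := fun l h => by
    rcases l with - | ⟨u, l⟩
    · simp at h
    refine ⟨((1 : k), (0 : (NDForm.diag l).V)), ?_⟩
    have := diag_apply u l 1 0
    rw [this]
    simp
  by_cases hA : ∃ z ∈ L, (NDForm.diag l).form z.1 z.1 ≠ 0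
  · obtain ⟨z, hz, hz0⟩ := hA
    obtain ⟨y, hy⟩ := exists_linSum_eq_of_value l h (Units.mk0 _ hz0) z.1 rfl
    obtain ⟨y', hy'⟩ := exists_linSum_eq_of_value l' h' (Units.mk0 _ hz0) z.2 (hLq z hz).symm
    exact ⟨_, y, y', hy, hy'⟩
  push Not at hA
  -- All values on `L` now vanish. If the first form were anisotropic, `L` would have zero first
  -- projection and, by dimension, be the whole second space, where some value is non-zero.
  have hiso : ∃ x : (NDForm.diag l).V, x ≠ 0 ∧ (NDForm.diag l).form x x = 0 := by
    by_contra! hcon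
    have hle : L ≤ LinearMap.range (LinearMap.inr k (NDForm.diag l).V (NDForm.diag l').V) :=
      fun z hz => ⟨z.2, Prod.ext (by_contra fun h0 => hcon z.1 (Ne.symm h0) (hA z hz)) rfl⟩
    have heq := Submodule.eq_of_le_of_finrank_le hle (by
      rw [LinearMap.finrank_range_of_inj LinearMap.inr_injective]
      change (NDForm.diag l').rank ≤ _
      rwa [rank_diag, ← hlen, ← rank_diag])
    obtain ⟨x, hx⟩ := hnz l' h'
    have hxL : ((0, x) : (NDForm.diag l).V × (NDForm.diag l').V) ∈ L := by
      rw [heq]; exact ⟨x, rfl⟩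
    exact hx ((hLq _ hxL).symm.trans (hA _ hxL))
  have hiso' : ∃ x : (NDForm.diag l').V, x ≠ 0 ∧ (NDForm.diag l').form x x = 0 := by
    by_contra! hcon
    have hle : L ≤ LinearMap.range (LinearMap.inl k (NDForm.diag l).V (NDForm.diag l').V) :=
      fun z hz => ⟨z.1, Prod.ext rfl
        (by_contra fun h0 => hcon z.2 (Ne.symm h0) ((hLq z hz).symm.trans (hA z hz)))⟩
    have heq := Submodule.eq_of_le_of_finrank_le hle (by
      rw [LinearMap.finrank_range_of_inj LinearMap.inl_injective]
      exact hL)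
    obtain ⟨x, hx⟩ := hnz l h
    have hxL : ((x, 0) : (NDForm.diag l).V × (NDForm.diag l').V) ∈ L := by
      rw [heq]; exact ⟨x, rfl⟩
    exact hx (hA _ hxL)
  obtain ⟨x, hx0, hx⟩ := hiso
  obtain ⟨x', hx0', hx'⟩ := hiso'
  obtain ⟨y, hy⟩ := exists_linSum_eq_of_isotropic l x hx0 hx
  obtain ⟨y', hy'⟩ := exists_linSum_eq_of_isotropic l' x' hx0' hx'
  exact ⟨1, y, y', hy, hy'⟩

/-- The Bézout form and its determinant classify naive homotopy classes. -/
theorem eq_of_bez_eq (n : ℕ) : ∀ x y : NaiveClass k, degree x = n → bez x = bez y →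
    bezDet x = bezDet y → x = y := by
  induction n with
  | zero =>
    intro x y hx hxy _
    rw [← rank_bez, hxy, rank_bez] at hx
    rw [eq_zero_of_degree hx, eq_zero_of_degree (x := x) (by rw [← rank_bez, hxy, rank_bez, hx])]
  | succ n ih =>
    intro x y hx hxy hdet
    have hy : degree y = n + 1 := by rw [← rank_bez, ← hxy, rank_bez, hx]
    obtain ⟨l, rfl⟩ := exists_eq_linSum x
    obtain ⟨l', rfl⟩ := exists_eq_linSum y
    rw [degree_linSum] at hx hy
    rcases n with - | n
    · obtain ⟨u, rfl⟩ := List.length_eq_one_iff.1 hx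
      obtain ⟨v, rfl⟩ := List.length_eq_one_iff.1 hy
      rw [bezDet_linSum, bezDet_linSum, List.prod_singleton, List.prod_singleton] at hdet
      rw [Additive.ofMul.injective hdet]
    · rw [bez_linSum, bez_linSum] at hxy
      obtain ⟨c, x', y', hx', hy'⟩ := exists_common_value l l' (by omega) (by omega) hxy
      rw [← bez_linSum, ← bez_linSum, hx', hy', map_add, map_add] at hxy
      rw [hx', hy', map_add, map_add] at hdet
      have hdeg := congrArg degree hx'
      rw [degree_linSum, map_add, degree_lin] at hdeg
      rw [hx', hy', ih x' y' (by omega) (MWs.add_cancel_left hxy) (add_left_cancel hdet)]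

/-- Every admissible determinant is realised. -/
theorem exists_bez_eq (b : MWs k) (u : kˣ) (h : MWs.disc b = Additive.ofMul (QuotientGroup.mk u))
    (h0 : MWs.rank b = 0 → u = 1) :
    ∃ x : NaiveClass k, bez x = b ∧ bezDet x = Additive.ofMul u := by
  obtain ⟨l, rfl⟩ := MWs.exists_eq_diag b
  rw [← bez_linSum, disc_bez, bezDet_linSum, toMul_ofMul] at h
  rw [← bez_linSum, rank_bez, degree_linSum] at h0
  rcases l with - | ⟨v, l⟩
  · refine ⟨0, map_zero bez, ?_⟩
    rw [map_zero, h0 rfl, ofMul_one]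
  · obtain ⟨s, hs⟩ := QuotientGroup.eq.1 (Additive.ofMul.injective h)
    refine ⟨linSum (v * s ^ 2 :: l), ?_, ?_⟩
    · rw [bez_linSum, MWs.diag_cons, MWs.unary_mul_sq, ← MWs.diag_cons]
    · rw [bezDet_linSum]
      congr 1
      rw [inv_mul_eq_iff_eq_mul] at hs
      rw [hs, List.prod_cons, List.prod_cons, pow_two, mul_right_comm]

end NaiveClass

/-! ## The signature -/

/-- The product of positive definite subspaces is positive definite. -/
theorem sigPos_add_le {V W : Type*} [AddCommGroup V] [Module ℝ V] [FiniteDimensional ℝ V]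
    [AddCommGroup W] [Module ℝ W] [FiniteDimensional ℝ W] {Q₁ : QuadraticForm ℝ V}
    {Q₂ : QuadraticForm ℝ W} {Q : QuadraticForm ℝ (V × W)} (h : ∀ x, Q x = Q₁ x.1 + Q₂ x.2) :
    sigPos Q₁ + sigPos Q₂ ≤ sigPos Q := by
  obtain ⟨V₁, h₁, hV₁⟩ := exists_finrank_eq_sigPos_and_posDef Q₁
  obtain ⟨V₂, h₂, hV₂⟩ := exists_finrank_eq_sigPos_and_posDef Q₂
  rw [← h₁, ← h₂, ← Module.finrank_prod]
  have hle : Module.finrank ℝ (V₁ × V₂) ≤ Module.finrank ℝ (V₁.prod V₂) :=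
    LinearMap.finrank_le_finrank_of_injective
      (f := (V₁.subtype.prodMap V₂.subtype).codRestrict (V₁.prod V₂) fun x => ⟨x.1.2, x.2.2⟩)
      fun x y h => by
        have h' := congrArg Subtype.val h
        exact Prod.ext (Subtype.ext (congrArg Prod.fst h')) (Subtype.ext (congrArg Prod.snd h'))
  refine hle.trans (le_sigPos_of_posDef Q (V := V₁.prod V₂) ?_)
  rintro ⟨⟨x, y⟩, hx, hy⟩ h0
  change 0 < Q (x, y)
  have h0' : x ≠ 0 ∨ y ≠ 0 := by
    by_contra! hcon
    exact h0 (Subtype.ext (Prod.ext hcon.1 hcon.2))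
  have hx0 : 0 ≤ Q₁ x := hV₁.nonneg ⟨x, hx⟩
  have hy0 : 0 ≤ Q₂ y := hV₂.nonneg ⟨y, hy⟩
  rw [h]
  rcases h0' with h0 | h0
  · exact add_pos_of_pos_of_nonneg (hV₁ ⟨x, hx⟩ fun h => h0 (congrArg Subtype.val h)) hy0
  · exact add_pos_of_nonneg_of_pos hx0 (hV₂ ⟨y, hy⟩ fun h => h0 (congrArg Subtype.val h))

namespace NDForm

/-- The signature of a real form. -/
noncomputable def signature (b : NDForm ℝ) : ℕ × ℕ :=
  (sigPos b.form.toQuadraticMap, sigNeg b.form.toQuadraticMap)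

theorem signature_sum (b : NDForm ℝ) : b.signature.1 + b.signature.2 = b.rank := by
  have h := QuadraticForm.sigPos_add_sigNeg_add_radical (Q := b.form.toQuadraticMap)
  have h0 : b.form.toQuadraticMap.radical = ⊥ := by
    rw [eq_bot_iff]
    intro x hx
    obtain ⟨hx0, hx⟩ := QuadraticMap.mem_radical_iff'.1 hx
    refine b.nondegenerate.1 x fun y => ?_
    have h1 := hx y
    simp only [LinearMap.BilinMap.toQuadraticMap_apply, map_add, LinearMap.add_apply] at h1 hx0
    have h2 := b.symm.eq x y
    linarith
  rwa [h0, finrank_bot, add_zero] at h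

theorem signature_add (b c : NDForm ℝ) : (b + c).signature = b.signature + c.signature := by
  have h₁ : b.signature.1 + c.signature.1 ≤ (b + c).signature.1 :=
    sigPos_add_le (Q₁ := b.form.toQuadraticMap) (Q₂ := c.form.toQuadraticMap)
      (Q := (b + c).form.toQuadraticMap) fun _ => rfl
  have h₂ : b.signature.2 + c.signature.2 ≤ (b + c).signature.2 :=
    sigPos_add_le (Q₁ := -b.form.toQuadraticMap) (Q₂ := -c.form.toQuadraticMap)
      (Q := -(b + c).form.toQuadraticMap) fun _ => neg_add _ _
  -- Positive and negative indices are both superadditive while their sum is the rank, so both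
  -- inequalities are equalities.
  have h₃ := signature_sum (b + c)
  rw [rank_add, ← signature_sum b, ← signature_sum c] at h₃
  refine Prod.ext ?_ ?_
  · rw [Prod.fst_add]; omega
  · rw [Prod.snd_add]; omega

theorem signature_eq_of_isometric {b c : NDForm ℝ} (h : Isometric b c) :
    b.signature = c.signature := by
  obtain ⟨e, he⟩ := h
  have h : QuadraticMap.Equivalent b.form.toQuadraticMap c.form.toQuadraticMap :=
    ⟨⟨e, fun x => he x x⟩⟩
  exact Prod.ext h.sigPos_eq h.sigNeg_eq

theorem signature_unary_one : (unary (1 : ℝˣ)).signature = (1, 0) := by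
  have h := signature_sum (unary (1 : ℝˣ))
  have hr : (unary (1 : ℝˣ)).rank = 1 := Module.finrank_self ℝ
  have h1 : (unary (1 : ℝˣ)).rank ≤ (unary (1 : ℝˣ)).signature.1 := by
    have := le_sigPos_of_posDef (unary (1 : ℝˣ)).form.toQuadraticMap (V := ⊤) (by
      rintro ⟨(x : ℝ), hx⟩ h0
      have hx0 : x ≠ 0 := fun h => h0 (Subtype.ext h)
      change 0 < ((1 : ℝˣ) : ℝ) * (x * x)
      rw [Units.val_one, one_mul]
      exact mul_self_pos.2 hx0)
    rwa [finrank_top] at this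
  refine Prod.ext ?_ ?_ <;> dsimp only <;> omega

theorem signature_unary_neg_one : (unary (-1 : ℝˣ)).signature = (0, 1) := by
  have h := signature_sum (unary (-1 : ℝˣ))
  have hr : (unary (-1 : ℝˣ)).rank = 1 := Module.finrank_self ℝ
  have h1 : (unary (-1 : ℝˣ)).rank ≤ (unary (-1 : ℝˣ)).signature.2 := by
    have := le_sigNeg_of_negDef (unary (-1 : ℝˣ)).form.toQuadraticMap (V := ⊤) (by
      rintro ⟨(x : ℝ), hx⟩ h0
      have hx0 : x ≠ 0 := fun h => h0 (Subtype.ext h)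
      change 0 < -(((-1 : ℝˣ) : ℝ) * (x * x))
      rw [Units.val_neg, Units.val_one, neg_mul, one_mul, neg_neg]
      exact mul_self_pos.2 hx0)
    rwa [finrank_top] at this
  refine Prod.ext ?_ ?_ <;> dsimp only <;> omega

end NDForm

/-- The signature of an isometry class. -/
noncomputable def MW.signature : MW ℝ →+ ℕ × ℕ where
  toFun := Quotient.lift NDForm.signature fun _ _ h => NDForm.signature_eq_of_isometric h
  map_zero' := by
    have h := NDForm.signature_sum 0
    rw [NDForm.rank_zero] at h
    change (0 : NDForm ℝ).signature = 0
    refine Prod.ext ?_ ?_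
    · rw [Prod.fst_zero]; omega
    · rw [Prod.snd_zero]; omega
  map_add' := by
    rintro ⟨b⟩ ⟨c⟩
    exact NDForm.signature_add b c

namespace MWs

/-- The signature of a stable isometry class. -/
noncomputable def signature : MWs ℝ →+ ℕ × ℕ :=
  (MW.stableCon ℝ).lift MW.signature (by
    rintro b c ⟨d, h⟩
    have := congrArg MW.signature h
    rw [map_add, map_add] at this
    exact add_right_cancel this)

theorem signature_combination (p q : ℕ) :
    signature (p • unary 1 + q • unary (-1)) = (p, q) := by
  have h1 : signature (unary 1) = (1, 0) := NDForm.signature_unary_one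
  have h2 : signature (unary (-1)) = (0, 1) := NDForm.signature_unary_neg_one
  rw [map_add, map_nsmul, map_nsmul, h1, h2]
  simp

/-- A positive real is a square, so only the sign of `u` matters. -/
theorem unary_real (u : ℝˣ) : unary u = unary 1 ∨ unary u = unary (-1) := by
  have hs : ∀ v : ℝˣ, 0 < (v : ℝ) → ∃ s : ℝˣ, v = s ^ 2 := fun v hv =>
    ⟨Units.mk0 (Real.sqrt v) (Real.sqrt_pos.2 hv).ne', Units.ext (Real.sq_sqrt hv.le).symm⟩
  rcases lt_or_gt_of_ne u.ne_zero with h | h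
  · obtain ⟨s, hs⟩ := hs (-u) (by simpa using h)
    right
    rw [← unary_mul_sq (-1) s, ← hs, mul_neg, neg_mul, one_mul, neg_neg]
  · obtain ⟨s, hs⟩ := hs u h
    left
    rw [← unary_mul_sq 1 s, ← hs, one_mul]

theorem exists_eq_combination (x : MWs ℝ) : ∃ p q : ℕ, x = p • unary 1 + q • unary (-1) := by
  obtain ⟨l, rfl⟩ := exists_eq_diag x
  induction l with
  | nil => exact ⟨0, 0, by rw [diag_nil, zero_nsmul, zero_nsmul, add_zero]⟩
  | cons u l ih =>
    obtain ⟨p, q, h⟩ := ih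
    rcases unary_real u with hu | hu
    · exact ⟨p + 1, q, by rw [diag_cons, h, hu, succ_nsmul', add_assoc]⟩
    · exact ⟨p, q + 1, by rw [diag_cons, h, hu, succ_nsmul', add_left_comm]⟩

theorem disc_unary {k : Type u} [Field k] (u : kˣ) :
    disc (unary u) = Additive.ofMul (QuotientGroup.mk u) := by
  rw [← NaiveClass.bez_lin, NaiveClass.disc_bez, NaiveClass.bezDet_lin, toMul_ofMul]

theorem rank_unary {k : Type u} [Field k] (u : kˣ) : rank (unary u) = 1 := Module.finrank_self k

/-- The discriminant is the class of `(-1) ^ q`, and real square classes are signs. -/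
theorem disc_combination_iff (p q : ℕ) (u : ℝˣ) :
    disc (p • unary 1 + q • unary (-1)) = Additive.ofMul (QuotientGroup.mk u) ↔
      (0 < (u : ℝ) ↔ Even q) := by
  have h1 : disc (p • unary 1 + q • unary (-1)) =
      Additive.ofMul (QuotientGroup.mk ((-1 : ℝˣ) ^ q)) := by
    rw [map_add, map_nsmul, map_nsmul, disc_unary, disc_unary, QuotientGroup.mk_one, ofMul_one,
      nsmul_zero, zero_add, ← ofMul_pow, QuotientGroup.mk_pow]
  rw [h1, Additive.ofMul.injective.eq_iff, QuotientGroup.eq]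
  have h2 : ((-1 : ℝˣ) ^ q)⁻¹ * u ∈ Subgroup.square ℝˣ ↔ 0 < (-1 : ℝ) ^ q * u := by
    have h3 : (((-1 : ℝˣ) ^ q)⁻¹ : ℝˣ) = (-1) ^ q := by
      rw [← inv_pow]; simp
    rw [h3, Subgroup.mem_square]
    constructor
    · rintro ⟨s, hs⟩
      have h4 := congrArg (Units.val) hs
      push_cast at h4
      rw [h4]
      exact mul_self_pos.2 s.ne_zero
    · intro h
      refine ⟨Units.mk0 (Real.sqrt ((-1 : ℝ) ^ q * u)) (Real.sqrt_pos.2 h).ne', Units.ext ?_⟩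
      push_cast
      exact (Real.mul_self_sqrt h.le).symm
  rw [h2]
  rcases Nat.even_or_odd q with hq | hq
  · simp [hq.neg_one_pow, hq]
  · have := u.ne_zero
    rw [hq.neg_one_pow]
    simp only [Nat.not_even_iff_odd.2 hq, iff_false, not_lt, neg_mul, one_mul, Left.neg_pos_iff]
    exact ⟨le_of_lt, fun h => lt_of_le_of_ne h this⟩

end MWs

/-! ### The isomorphisms onto the three targets -/

namespace NaiveClass

variable {k : Type u} [Field k]

/-- The class of the Bézout form together with its determinant. -/
noncomputable def toWittDet : NaiveClass k →+ WittDet k :=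
  (bez.prod bezDet).codRestrict (WittDet k) fun x => ⟨disc_bez x, fun h => by
    have h0 : x = 0 := eq_zero_of_degree ((rank_bez x).symm.trans h)
    rw [h0]; exact map_zero bezDet⟩

theorem toWittDet_bijective : Function.Bijective (toWittDet (k := k)) := by
  constructor
  · intro x y h
    have h' := congrArg Subtype.val h
    exact eq_of_bez_eq _ x y rfl (congrArg Prod.fst h') (congrArg Prod.snd h')
  · rintro ⟨⟨b, u⟩, h, h0⟩
    obtain ⟨x, hx, hx'⟩ := exists_bez_eq b u.toMul h fun hb => congrArg Additive.toMul (h0 hb)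
    exact ⟨x, Subtype.ext (Prod.ext hx hx')⟩

/-- The degree together with the determinant of the Bézout form. -/
noncomputable def toDegDet : NaiveClass k →+ DegDet k :=
  (degree.prod bezDet).codRestrict (DegDet k) fun x h => by
    have h0 : x = 0 := eq_zero_of_degree h
    rw [h0]; exact map_zero bezDet

/-- All units are squares, so a stable class is determined by its rank and the discriminant imposes
no condition. -/
theorem toDegDet_bijective [IsAlgClosed k] : Function.Bijective (toDegDet (k := k)) := by
  have hsq : ∀ u : kˣ, ∃ s : kˣ, u = s ^ 2 := fun u => by
    obtain ⟨z, hz⟩ := IsAlgClosed.exists_pow_nat_eq (u : k) two_pos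
    have hz0 : z ≠ 0 := by
      rintro rfl
      exact u.ne_zero (by rw [← hz]; simp)
    exact ⟨Units.mk0 z hz0, Units.ext hz.symm⟩
  have hunary : ∀ u : kˣ, MWs.unary u = MWs.unary 1 := fun u => by
    obtain ⟨s, hs⟩ := hsq u
    rw [← MWs.unary_mul_sq 1 s, one_mul, ← hs]
  have hbez : ∀ b : MWs k, b = MWs.rank b • MWs.unary 1 := fun b => by
    obtain ⟨l, rfl⟩ := MWs.exists_eq_diag b
    induction l with
    | nil => rw [MWs.diag_nil, map_zero, zero_nsmul]
    | cons u l ih =>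
      rw [MWs.diag_cons, map_add, add_smul, ← ih, MWs.rank_unary, one_smul, hunary]
  constructor
  · intro x y h
    have h' := congrArg Subtype.val h
    have hdeg : degree x = degree y := congrArg Prod.fst h'
    refine eq_of_bez_eq _ x y rfl ?_ (congrArg Prod.snd h')
    rw [hbez (bez x), hbez (bez y), rank_bez, rank_bez, hdeg]
  · rintro ⟨⟨n, u⟩, h⟩
    have hrank : MWs.rank (n • MWs.unary (1 : kˣ)) = n := by
      rw [map_nsmul, MWs.rank_unary, smul_eq_mul, mul_one]
    obtain ⟨x, hx, hx'⟩ := exists_bez_eq (n • MWs.unary 1) u.toMul (by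
      rw [map_nsmul, MWs.disc_unary, QuotientGroup.mk_one, ofMul_one, nsmul_zero]
      obtain ⟨s, hs⟩ := hsq u.toMul
      exact congrArg Additive.ofMul (QuotientGroup.eq.2 (by
        rw [inv_one, one_mul, hs]; exact ⟨s, pow_two s⟩))) fun hb =>
        congrArg Additive.toMul (h (hrank.symm.trans hb))
    refine ⟨x, Subtype.ext (Prod.ext ?_ hx')⟩
    change degree x = n
    rw [← rank_bez, hx, hrank]

theorem rank_combination (p q : ℕ) :
    MWs.rank (p • MWs.unary (1 : ℝˣ) + q • MWs.unary (-1)) = p + q := by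
  rw [map_add, map_nsmul, map_nsmul, MWs.rank_unary, MWs.rank_unary, smul_eq_mul, smul_eq_mul,
    mul_one, mul_one]

/-- The signature of the Bézout form together with its determinant. -/
noncomputable def toSigDet : NaiveClass ℝ →+ SigDet :=
  ((MWs.signature.comp bez).prod bezDet).codRestrict SigDet fun x => by
    obtain ⟨p, q, h⟩ := MWs.exists_eq_combination (bez x)
    have hsig : MWs.signature (bez x) = (p, q) := by rw [h, MWs.signature_combination]
    constructor
    · have hd := disc_bez x
      rw [h, MWs.disc_combination_iff] at hd
      change _ ↔ Even (MWs.signature (bez x)).2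
      rw [hsig]
      exact hd
    · intro h0
      change MWs.signature (bez x) = 0 at h0
      rw [hsig, Prod.mk_eq_zero] at h0
      have h1 : x = 0 := eq_zero_of_degree (by
        rw [← rank_bez, h, rank_combination, h0.1, h0.2, add_zero])
      rw [h1]; exact map_zero bezDet

/-- Every stable class over `ℝ` is `p⟨1⟩ + q⟨-1⟩`, with `(p, q)` recovered by the signature. The
sign condition on `u` is exactly the condition on the discriminant. -/
theorem toSigDet_bijective : Function.Bijective toSigDet := by
  constructor
  · intro x y h
    have h' := congrArg Subtype.val h
    have hsig : MWs.signature (bez x) = MWs.signature (bez y) := congrArg Prod.fst h'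
    refine eq_of_bez_eq _ x y rfl ?_ (congrArg Prod.snd h')
    obtain ⟨p, q, hx⟩ := MWs.exists_eq_combination (bez x)
    obtain ⟨p', q', hy⟩ := MWs.exists_eq_combination (bez y)
    rw [hx, hy, MWs.signature_combination, MWs.signature_combination, Prod.mk.injEq] at hsig
    rw [hx, hy, hsig.1, hsig.2]
  · rintro ⟨⟨⟨p, q⟩, u⟩, h, h0⟩
    obtain ⟨x, hx, hx'⟩ := exists_bez_eq (p • MWs.unary 1 + q • MWs.unary (-1)) u.toMul
      ((MWs.disc_combination_iff p q u.toMul).2 h) fun hb => by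
        rw [rank_combination, Nat.add_eq_zero_iff] at hb
        exact congrArg Additive.toMul (h0 (Prod.ext hb.1 hb.2))
    refine ⟨x, Subtype.ext (Prod.ext ?_ hx')⟩
    change MWs.signature (bez x) = (p, q)
    rw [hx, MWs.signature_combination]

end NaiveClass

theorem corollary3p5 (k : Type*) [Field k] :
    -- the canonical isomorphism of graded monoids
    (∃ e : NaiveClass k ≃+ WittDet k,
      (∀ f : PointedRat k, (e (NaiveClass.mk f) : MWs k × Additive kˣ) =
        (MWs.mk f.bezForm, Additive.ofMul f.bezDet)) ∧
      (∀ x : NaiveClass k, WittDet.degree (e x) = NaiveClass.degree x)) ∧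
    -- the determinant of the Bézout form is the resultant, up to the usual sign
    (∀ f : PointedRat k, (f.bezDet : k) = (-1) ^ (f.deg * (f.deg - 1) / 2) * f.res) ∧
    -- algebraically closed fields
    (IsAlgClosed k → ∃ e : NaiveClass k ≃+ DegDet k,
      ∀ f : PointedRat k, (e (NaiveClass.mk f) : ℕ × Additive kˣ) =
        (f.deg, Additive.ofMul f.bezDet)) ∧
    -- the field of real numbers
    (∃ e : NaiveClass ℝ ≃+ SigDet,
      ∀ f : PointedRat ℝ, (e (NaiveClass.mk f) : (ℕ × ℕ) × Additive ℝˣ) =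
        (f.signature, Additive.ofMul f.bezDet)) :=
  ⟨⟨AddEquiv.ofBijective _ NaiveClass.toWittDet_bijective, fun _ => rfl, NaiveClass.rank_bez⟩,
    fun f => NaiveClass.coe_bezDet_eq _ f rfl,
    fun _ => ⟨AddEquiv.ofBijective _ NaiveClass.toDegDet_bijective, fun _ => rfl⟩,
    ⟨AddEquiv.ofBijective _ NaiveClass.toSigDet_bijective, fun _ => rfl⟩⟩
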